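/- Let $k\ge 0$ and $n\ge 2k+3$ be integers. Let $(\Sigma^{k+1},g_\Sigma)$ be a compact hyperbolic manifold, that is, a compact smooth Riemannian manifold which is a quotient of hyperbolic space $H^{k+1}$ (equivalently, there is a Riemannian covering $p\colon H^{k+1}\to\Sigma$; for $k=0$, where $H^1\cong\mathbb{R}$, these are the circles). Let $$(M,g):=\bigl(S^{n-k-1}\times\Sigma^{k+1},\; g_{S^{n-k-1}}\oplus g_\Sigma\bigr)$$ be the Riemannian product with the unit round sphere. Then: 1. The scalar curvature of $g$ is constant and positive: $R_g\equiv (n-2k-2)(n-1)>0$. 2. The Yamabe constant of the conformal class of $g$ is positive: $$Y(M,[g])=\inf_{0<u\in C^\infty(M)}\frac{\int_M\bigl(\tfrac{4(n-1)}{n-2}|\nabla u|_g^2+R_g u^2\bigr)\,dv_g}{\bigl(\int_M u^{\frac{2n}{n-2}}\,dv_g\bigr)^{\frac{n-2}{n}}}>0 .$$ 3. For every Riemannian covering $p\colon H^{k+1}\to\Sigma$, the map $\mathrm{id}\times p\colon S^{n-k-1}\times H^{k+1}\to M$ is a universal covering and is a Riemannian covering for the product metrics. Every universal covering $\pi\colon\widetilde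 M\to M$ has total space $\widetilde M$ diffeomorphic to $S^{n-k-1}\times\mathbb{R}^{k+1}$; moreover $\widetilde M$ is not contractible, and $(\widetilde M,\pi^*g)$ is not conformally equivalent to Euclidean space $(\mathbb{R}^n,\delta)$, that is, there are no diffeomorphism $\Phi\colon\widetilde M\to\mathbb{R}^n$ and function $u\in C^\infty(\widetilde M)$ with $\Phi^*\delta=e^{2u}\pi^*g$. -/

import Mathlib

open scoped Manifold ContDiff
open Module MeasureTheory

noncomputable section

/-! ### Symmetric two-tensors on manifolds -/

section Tensors

variable {E : Type*} [NormedAddCommGroup E] [NormedSpace ℝ E]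
  {H : Type*} [TopologicalSpace H] {I : ModelWithCorners ℝ E H}
  {M : Type*} [TopologicalSpace M] [ChartedSpace H M]
  {F : Type*} [NormedAddCommGroup F] [NormedSpace ℝ F]
  {G : Type*} [TopologicalSpace G] {J : ModelWithCorners ℝ F G}
  {N : Type*} [TopologicalSpace N] [ChartedSpace G N]

/-- A field of bilinear forms on the tangent spaces of a manifold. -/
abbrev TwoTensor {E : Type*} [NormedAddCommGroup E] [NormedSpace ℝ E]
    {H : Type*} [TopologicalSpace H] (I : ModelWithCorners ℝ E H)
    (M : Type*) [TopologicalSpace M] [ChartedSpace H M] : Type _ :=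
  ∀ x : M, LinearMap.BilinForm ℝ (TangentSpace I x)

/-- The pullback `f^* g`. -/
def TwoTensor.pullback (I : ModelWithCorners ℝ E H) (g : TwoTensor J N) (f : M → N) :
    TwoTensor I M :=
  fun x => (g (f x)).compl₁₂ (mfderiv I J f x).toLinearMap (mfderiv I J f x).toLinearMap

/-- The product tensor `g ⊕ h = pr₁^* g + pr₂^* h`. -/
def TwoTensor.prod (g : TwoTensor I M) (h : TwoTensor J N) : TwoTensor (I.prod J) (M × N) :=
  fun p => TwoTensor.pullback (I.prod J) g Prod.fst p + TwoTensor.pullback (I.prod J) h Prod.snd p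

/-- The two-tensor underlying a smooth Riemannian metric. -/
def riemannianTensor [IsManifold I ∞ M]
    (g : Bundle.ContMDiffRiemannianMetric I ∞ E (TangentSpace I : M → Type _)) : TwoTensor I M :=
  fun x => LinearMap.mk₂ ℝ (fun v w => g.inner x v w) (by simp) (by simp) (by simp) (by simp)

/-- `(M, g)` and `(N, h)` are conformally equivalent: there is a diffeomorphism `Φ : M → N` with
`Φ^* h = e^{2u} g` for a smooth function `u`. -/
def ConformallyEquivalent (g : TwoTensor I M) (h : TwoTensor J N) : Prop :=
  ∃ (Φ : M ≃ₘ^∞⟮I, J⟯ N) (u : M → ℝ), ContMDiff I 𝓘(ℝ, ℝ) ∞ u ∧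
    TwoTensor.pullback I h Φ = fun x => Real.exp (2 * u x) • g x

/-- A smooth covering map. -/
def IsSmoothCovering (I : ModelWithCorners ℝ E H) (J : ModelWithCorners ℝ F G)
    (p : M → N) : Prop :=
  IsCoveringMap p ∧ Function.Surjective p ∧ IsLocalDiffeomorph I J ∞ p

/-- A Riemannian covering `(M, g) → (N, h)`. -/
def IsRiemannianCovering (g : TwoTensor I M) (h : TwoTensor J N) (p : M → N) : Prop :=
  IsSmoothCovering I J p ∧ TwoTensor.pullback I h p = g

/-- A universal covering in the smooth category. -/
def IsUniversalCovering (I : ModelWithCorners ℝ E H) (J : ModelWithCorners ℝ F G)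
    (p : M → N) : Prop :=
  SimplyConnectedSpace M ∧ IsSmoothCovering I J p

end Tensors

/-! ### Curvature in coordinates -/

section LocalCurvature

variable {E : Type*} [NormedAddCommGroup E] [NormedSpace ℝ E]
  {ι : Type*} [Fintype ι] [DecidableEq ι]

/-- The matrix of a bilinear form with respect to a basis. -/
def gram (b : Basis ι ℝ E) (B : LinearMap.BilinForm ℝ E) : Matrix ι ι ℝ :=
  Matrix.of fun i j => B (b i) (b j)

/-- The Christoffel symbols of `g` on the vector space `E`, as an `E`-valued bilinear expression:
`Γ(v,w) = ∑ g^{lm} ½ (∂_v g(w,b_m) + ∂_w g(v,b_m) - ∂_{b_m} g(v,w)) b_l`. -/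
def christoffel (b : Basis ι ℝ E) (g : E → LinearMap.BilinForm ℝ E) (y v w : E) : E :=
  ∑ l, ∑ m, ((gram b (g y))⁻¹ l m * (1 / 2 : ℝ) *
    (fderiv ℝ (fun z => g z w (b m)) y v + fderiv ℝ (fun z => g z v (b m)) y w
      - fderiv ℝ (fun z => g z v w) y (b m))) • b l

/-- The curvature `R(u,v)w = ∇_u ∇_v w - ∇_v ∇_u w` for constant vector fields `u, v, w` on `E`. -/
def localCurvature (b : Basis ι ℝ E) (g : E → LinearMap.BilinForm ℝ E) (y u v w : E) : E :=
  fderiv ℝ (fun z => christoffel b g z v w) y u - fderiv ℝ (fun z => christoffel b g z u w) y v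
    + christoffel b g y u (christoffel b g y v w) - christoffel b g y v (christoffel b g y u w)

/-- The Ricci curvature: the trace of `u ↦ R(u,v)w`. -/
def localRicci (b : Basis ι ℝ E) (g : E → LinearMap.BilinForm ℝ E) (y v w : E) : ℝ :=
  ∑ i, b.coord i (localCurvature b g y (b i) v w)

/-- The scalar curvature: the `g`-trace of the Ricci curvature. -/
def localScalarCurvature (b : Basis ι ℝ E) (g : E → LinearMap.BilinForm ℝ E) (y : E) : ℝ :=
  ∑ i, ∑ j, (gram b (g y))⁻¹ i j * localRicci b g y (b i) (b j)

end LocalCurvature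

/-! ### Scalar curvature, volume and Yamabe constant of a manifold without boundary -/

section Yamabe

variable {E : Type*} [NormedAddCommGroup E] [NormedSpace ℝ E] [FiniteDimensional ℝ E]
  {H : Type*} [TopologicalSpace H] {I : ModelWithCorners ℝ E H}
  {M : Type*} [TopologicalSpace M] [ChartedSpace H M]

/-- The coefficients of `g` in the preferred chart at `x`, as a field of bilinear forms on `E`. -/
def chartCoefficients (g : TwoTensor I M) (x : M) : E → LinearMap.BilinForm ℝ E :=
  fun y => TwoTensor.pullback 𝓘(ℝ, E) g (extChartAt I x).symm y

/-- The scalar curvature `R_g`. -/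
def scalarCurvature (g : TwoTensor I M) (x : M) : ℝ :=
  localScalarCurvature (finBasis ℝ E) (chartCoefficients g x) (extChartAt I x x)

/-- `|∇u|_g^2 = g^{ij} ∂_i u ∂_j u`, computed in a basis of the tangent space at `x`. -/
def gradNormSq (g : TwoTensor I M) (u : M → ℝ) (x : M) : ℝ :=
  ∑ i, ∑ j, (gram (E := E) (finBasis ℝ E) (g x))⁻¹ i j *
    (show E →L[ℝ] ℝ from mfderiv I 𝓘(ℝ, ℝ) u x) (finBasis ℝ E i) *
    (show E →L[ℝ] ℝ from mfderiv I 𝓘(ℝ, ℝ) u x) (finBasis ℝ E j)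

variable [MeasurableSpace E] [BorelSpace E] [MeasurableSpace M] [BorelSpace M]

/-- The measure `√(det g_ij) dy` on the domain of the preferred chart at `x`, extended by zero. -/
def chartVolume (g : TwoTensor I M) (x : M) : Measure M :=
  Measure.map (extChartAt I x).symm
    (((finBasis ℝ E).addHaar.restrict (extChartAt I x).target).withDensity fun y =>
      ENNReal.ofReal √(gram (finBasis ℝ E) (chartCoefficients g x y)).det)

/-- The Riemannian volume measure `dv_g`. The measures `chartVolume g x` agree on the overlaps of
the chart domains, so their supremum is the measure that restricts to each of them. -/
def riemannianVolume (g : TwoTensor I M) : Measure M :=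
  ⨆ x : M, chartVolume g x

/-- The Yamabe quotient
`(∫ a_n |∇u|² + R_g u²) / (∫ u^{2n/(n-2)})^{(n-2)/n}` with `n = dim M`, `a_n = 4(n-1)/(n-2)`. -/
def yamabeQuotient (g : TwoTensor I M) (u : M → ℝ) : ℝ :=
  let n : ℝ := finrank ℝ E
  (∫ x, (4 * (n - 1) / (n - 2) * gradNormSq g u x + scalarCurvature g x * u x ^ 2)
      ∂riemannianVolume g) /
    (∫ x, u x ^ (2 * n / (n - 2)) ∂riemannianVolume g) ^ ((n - 2) / n)

/-- The Yamabe constant: the infimum of the Yamabe quotient over positive smooth functions. -/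
def yamabeConstant (g : TwoTensor I M) : ℝ :=
  ⨅ u : {u : M → ℝ // ContMDiff I 𝓘(ℝ, ℝ) ∞ u ∧ ∀ x, 0 < u x}, yamabeQuotient g u.1

end Yamabe

/-! ### The model spaces -/

/-- The flat metric of `ℝ^d`. -/
def flatMetric (d : ℕ) : TwoTensor (𝓡 d) (EuclideanSpace ℝ (Fin d)) :=
  fun _ => innerₗ (EuclideanSpace ℝ (Fin d))

/-- The unit sphere `S^d` in `ℝ^{d+1}`. -/
abbrev UnitSphere (d : ℕ) : Type :=
  Metric.sphere (0 : EuclideanSpace ℝ (Fin (d + 1))) 1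

/-- The round metric of `S^d`. -/
def roundMetric (d : ℕ) : TwoTensor (𝓡 d) (UnitSphere d) :=
  TwoTensor.pullback (𝓡 d) (flatMetric (d + 1)) Subtype.val

/-- The open upper half-space of `ℝ^{k+1}`. -/
def upperHalfSpace (k : ℕ) : TopologicalSpace.Opens (EuclideanSpace ℝ (Fin (k + 1))) :=
  ⟨{y | 0 < y 0}, isOpen_lt continuous_const (by fun_prop)⟩

/-- The hyperbolic metric `|dy|² / y_0²` of `H^{k+1}`, in the upper half-space model. -/
def hyperbolicMetric (k : ℕ) : TwoTensor (𝓡 (k + 1)) (upperHalfSpace k) :=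
  fun y => (1 / (y.1 0) ^ 2 : ℝ) •
    TwoTensor.pullback (𝓡 (k + 1)) (flatMetric (k + 1)) Subtype.val y

/-- `(S, g)` is a compact hyperbolic manifold of dimension `k + 1`, that is, a compact quotient of
`H^{k+1}`: it is compact and `H^{k+1}` covers it by a Riemannian covering map. For `k = 0` these
are the circles. -/
def IsCompactHyperbolic {k : ℕ} {S : Type*} [TopologicalSpace S]
    [ChartedSpace (EuclideanSpace ℝ (Fin (k + 1))) S]
    (g : TwoTensor (𝓡 (k + 1)) S) : Prop :=
  CompactSpace S ∧ ∃ p : upperHalfSpace k → S, IsRiemannianCovering (hyperbolicMetric k) g p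

end

/-!
In stereographic coordinates on the sphere, and in coordinates lifted to the half-space on a
hyperbolic manifold, the product metric is `c₁⟨·,·⟩ ⊕ c₂⟨·,·⟩` with explicit conformal factors `cᵢ`.
Its Levi-Civita connection is then explicit, and on the factors its Ricci endomorphism is scalar,
which gives the scalar curvature `(m - 1) m - k (k + 1)` of the product of an `m`-sphere with a
hyperbolic manifold of dimension `k + 1`. Positivity of the Yamabe constant is the Sobolev
inequality of a compact manifold, which follows from the Euclidean one by cutting off in finitely
many charts: since the scalar curvature is a positive constant, the numerator of the Yamabe quotient
dominates a positive multiple of `∫ |∇u|² + u²`.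

As `m ≥ 2`, the sphere is simply connected, so the covering by `S^m × H^{k+1}` is universal, and
universal coverings are unique up to diffeomorphism. The half-space is contractible but the sphere
is not, since a contraction would give a `C¹` retraction `r` of the ball onto the sphere: the
integral over the ball of the determinant of `Dr` vanishes because `|r| = 1`, yet it equals the
volume of the ball because `r` is the identity on the sphere. Hence no universal covering is even
homeomorphic to Euclidean space.
-/

noncomputable section

/-! ### Gram matrices and the dual metric -/

/-- A symmetric positive definite bilinear form: what a Riemannian metric is at each point. -/
structure IsInnerProduct {V : Type*} [AddCommGroup V] [Module ℝ V]
    (B : LinearMap.BilinForm ℝ V) : Prop where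
  symm : ∀ v w, B v w = B w v
  pos : ∀ v, v ≠ 0 → 0 < B v v

namespace IsInnerProduct

variable {V W : Type*} [AddCommGroup V] [Module ℝ V] [AddCommGroup W] [Module ℝ W]
  {B : LinearMap.BilinForm ℝ V} {C : LinearMap.BilinForm ℝ W}

theorem isSymm (hB : IsInnerProduct B) : B.IsSymm := ⟨hB.symm⟩

theorem nonneg (hB : IsInnerProduct B) (v : V) : 0 ≤ B v v := by
  rcases eq_or_ne v 0 with rfl | hv
  · simp
  · exact (hB.pos v hv).le

theorem nondegenerate (hB : IsInnerProduct B) : B.Nondegenerate :=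
  have hleft : ∀ v, (∀ w, B v w = 0) → v = 0 := fun v hv => by
    by_contra h
    exact (hB.pos v h).ne' (hv v)
  ⟨hleft, fun w hw => hleft w fun v => by rw [hB.symm, hw]⟩

theorem compl₁₂ (hB : IsInnerProduct B) {A : W →ₗ[ℝ] V} (hA : Function.Injective A) :
    IsInnerProduct (B.compl₁₂ A A) where
  symm v w := hB.symm (A v) (A w)
  pos v hv := hB.pos (A v) ((map_ne_zero_iff A hA).2 hv)

theorem compl₁₂_fst_add_compl₁₂_snd (hB : IsInnerProduct B) (hC : IsInnerProduct C) :
    IsInnerProduct (B.compl₁₂ (LinearMap.fst ℝ V W) (LinearMap.fst ℝ V W) +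
      C.compl₁₂ (LinearMap.snd ℝ V W) (LinearMap.snd ℝ V W)) where
  symm v w := congrArg₂ (· + ·) (hB.symm v.1 w.1) (hC.symm v.2 w.2)
  pos v hv := by
    rcases not_and_or.1 (mt Prod.ext_iff.2 hv) with h | h
    · exact add_pos_of_pos_of_nonneg (hB.pos v.1 h) (hC.nonneg v.2)
    · exact add_pos_of_nonneg_of_pos (hB.nonneg v.1) (hC.pos v.2 h)

end IsInnerProduct

section GramMatrix

variable {E : Type*} [NormedAddCommGroup E] [NormedSpace ℝ E]
  {F : Type*} [NormedAddCommGroup F] [NormedSpace ℝ F]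
  {ι κ : Type*} [Fintype ι] [DecidableEq ι] [Fintype κ] [DecidableEq κ]
  {B : LinearMap.BilinForm ℝ E}

theorem gram_eq_toMatrix (b : Basis ι ℝ E) (B : LinearMap.BilinForm ℝ E) :
    gram b B = LinearMap.BilinForm.toMatrix b B := by
  ext i j
  simp [gram, LinearMap.BilinForm.toMatrix_apply]

theorem isUnit_det_gram (b : Basis ι ℝ E) (hB : B.Nondegenerate) : IsUnit (gram b B).det := by
  rw [gram_eq_toMatrix, isUnit_iff_ne_zero]
  exact (LinearMap.BilinForm.nondegenerate_iff_det_ne_zero b).1 hB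

theorem det_gram_pos (b : Basis ι ℝ E) (hB : IsInnerProduct B) : 0 < (gram b B).det := by
  rw [gram_eq_toMatrix]
  exact ((LinearMap.BilinForm.posDef_toQuadraticMap_iff_matrix b B hB.isSymm).1 hB.pos).det_pos

theorem det_gram_compl₁₂ (b : Basis ι ℝ E) (B : LinearMap.BilinForm ℝ E) (A : E →ₗ[ℝ] E) :
    (gram b (B.compl₁₂ A A)).det = LinearMap.det A ^ 2 * (gram b B).det := by
  rw [gram_eq_toMatrix, gram_eq_toMatrix, show B.compl₁₂ A A = B.comp A A from rfl,
    LinearMap.BilinForm.toMatrix_comp b b, Matrix.det_mul, Matrix.det_mul, Matrix.det_transpose,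
    LinearMap.det_toMatrix]
  ring

theorem sum_gram_inv_mul (b : Basis ι ℝ E) (hsymm : B.IsSymm) (hB : B.Nondegenerate) (v : E)
    (i : ι) : ∑ j, (gram b B)⁻¹ i j * B v (b j) = b.repr v i := by
  have happly (j : ι) : B v (b j) = (gram b B).mulVec (b.repr v) j := by
    conv_lhs => rw [← b.sum_repr v]
    simp only [map_sum, map_smul, LinearMap.sum_apply, LinearMap.smul_apply, smul_eq_mul,
      Matrix.mulVec, dotProduct, gram, Matrix.of_apply]
    exact Finset.sum_congr rfl fun i _ => by rw [hsymm.eq, mul_comm]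
  calc ∑ j, (gram b B)⁻¹ i j * B v (b j)
      = (gram b B)⁻¹.mulVec ((gram b B).mulVec (b.repr v)) i := by
        simp only [happly, Matrix.mulVec, dotProduct]
    _ = b.repr v i := by
        rw [Matrix.mulVec_mulVec, Matrix.nonsing_inv_mul _ (isUnit_det_gram b hB),
          Matrix.one_mulVec]

/-- The squared length `B^{ij} ℓ_i ℓ_j` of a covector `ℓ` in the metric dual to `B`. -/
def cometric (b : Basis ι ℝ E) (B : LinearMap.BilinForm ℝ E) (l : E →L[ℝ] ℝ) : ℝ :=
  ∑ i, ∑ j, (gram b B)⁻¹ i j * l (b i) * l (b j)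

theorem cometric_eq_apply (b : Basis ι ℝ E) (hB : IsInnerProduct B) {l : E →L[ℝ] ℝ} {w : E}
    (hw : ∀ v, B w v = l v) : cometric b B l = l w := by
  have hrow (i : ι) : ∑ j, (gram b B)⁻¹ i j * l (b i) * l (b j) = b.repr w i * l (b i) := by
    rw [← sum_gram_inv_mul b hB.isSymm hB.nondegenerate w i, Finset.sum_mul]
    exact Finset.sum_congr rfl fun j _ => by rw [hw, mul_right_comm]
  conv_rhs => rw [← b.sum_repr w, map_sum]
  exact Finset.sum_congr rfl fun i _ => by rw [hrow, map_smul, smul_eq_mul]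

theorem IsInnerProduct.exists_riesz [FiniteDimensional ℝ E] (hB : IsInnerProduct B)
    (l : E →L[ℝ] ℝ) : ∃ w, ∀ v, B w v = l v :=
  ⟨(B.toDual hB.nondegenerate).symm l.toLinearMap, fun v => by
    rw [LinearMap.BilinForm.apply_toDual_symm_apply]; rfl⟩

theorem cometric_compl₁₂ (b : Basis ι ℝ E) (b' : Basis κ ℝ F) (hB : IsInnerProduct B)
    (l : E →L[ℝ] ℝ) (A : F ≃L[ℝ] E) :
    cometric b' (B.compl₁₂ A.toLinearMap A.toLinearMap) (l.comp (A : F →L[ℝ] E)) =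
      cometric b B l := by
  have : FiniteDimensional ℝ E := b.finiteDimensional_of_finite
  obtain ⟨w, hw⟩ := hB.exists_riesz l
  rw [cometric_eq_apply b hB hw,
    cometric_eq_apply (w := A.symm w) b' (hB.compl₁₂ A.injective) fun v => by simp [hw]]
  simp

theorem cometric_nonneg (b : Basis ι ℝ E) (hB : IsInnerProduct B) (l : E →L[ℝ] ℝ) :
    0 ≤ cometric b B l := by
  have : FiniteDimensional ℝ E := b.finiteDimensional_of_finite
  obtain ⟨w, hw⟩ := hB.exists_riesz l
  rw [cometric_eq_apply b hB hw, ← hw]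
  exact hB.nonneg w

theorem apply_sq_le_cometric_mul (b : Basis ι ℝ E) (hB : IsInnerProduct B) (l : E →L[ℝ] ℝ)
    (v : E) : l v ^ 2 ≤ cometric b B l * B v v := by
  have : FiniteDimensional ℝ E := b.finiteDimensional_of_finite
  obtain ⟨w, hw⟩ := hB.exists_riesz l
  rw [cometric_eq_apply b hB hw, ← hw, ← hw]
  exact LinearMap.BilinForm.apply_sq_le_of_symm B hB.nonneg ⟨hB.symm⟩ w v

theorem norm_sq_le_mul_cometric (b : Basis ι ℝ E) (hB : IsInnerProduct B) {Λ : ℝ} (hΛ : 0 ≤ Λ)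
    (hBΛ : ∀ v, B v v ≤ Λ * ‖v‖ ^ 2) (l : E →L[ℝ] ℝ) : ‖l‖ ^ 2 ≤ Λ * cometric b B l := by
  have hnonneg := cometric_nonneg b hB l
  have hbound (v : E) : ‖l v‖ ≤ √(Λ * cometric b B l) * ‖v‖ := by
    rw [Real.norm_eq_abs, ← Real.sqrt_sq (norm_nonneg v), ← Real.sqrt_mul (by positivity)]
    refine Real.abs_le_sqrt ?_
    calc l v ^ 2 ≤ cometric b B l * B v v := apply_sq_le_cometric_mul b hB l v
      _ ≤ cometric b B l * (Λ * ‖v‖ ^ 2) := by gcongr; exact hBΛ v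
      _ = Λ * cometric b B l * ‖v‖ ^ 2 := by ring
  calc ‖l‖ ^ 2 ≤ √(Λ * cometric b B l) ^ 2 := by
        gcongr
        exact l.opNorm_le_bound (Real.sqrt_nonneg _) hbound
    _ = Λ * cometric b B l := Real.sq_sqrt (by positivity)

end GramMatrix

/-! ### Curvature under local isometries of coordinate domains -/

section LeviCivita

open scoped Topology

variable {E : Type*} [NormedAddCommGroup E] [NormedSpace ℝ E]
  {F : Type*} [NormedAddCommGroup F] [NormedSpace ℝ F]
  {ι : Type*} [Fintype ι] [DecidableEq ι] {b : Basis ι ℝ E}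
  {g : E → LinearMap.BilinForm ℝ E} {h : F → F →L[ℝ] F →L[ℝ] ℝ} {Γ : F → F →L[ℝ] F →L[ℝ] F}
  {φ : E → F} {y : E}

/-- The bilinear map `Γ` is, at the point `x`, the Christoffel symbol of the Levi-Civita connection
of the metric `h`. Metrics on a model domain are encoded as fields of continuous bilinear forms, so
that they can be differentiated. -/
structure IsLeviCivitaAt (h : F → F →L[ℝ] F →L[ℝ] ℝ) (Γ : F → F →L[ℝ] F →L[ℝ] F) (x : F) :
    Prop where
  symm : ∀ v w, h x v w = h x w v
  nondegenerate : ∀ v, (∀ w, h x v w = 0) → v = 0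
  differentiableAt : DifferentiableAt ℝ h x
  koszul : ∀ v w z, 2 * h x (Γ x v w) z =
    fderiv ℝ h x v w z + fderiv ℝ h x w v z - fderiv ℝ h x z v w

/-- The curvature `R(u,v)w` at `x` of the connection with Christoffel symbol `Γ`. -/
def connectionCurvature (Γ : F → F →L[ℝ] F →L[ℝ] F) (x u v w : F) : F :=
  fderiv ℝ Γ x u v w - fderiv ℝ Γ x v u w + Γ x u (Γ x v w) - Γ x v (Γ x u w)

/-- The operator `u ↦ R(u,v)w`, whose trace is the Ricci curvature. -/
def ricciOperator (Γ : F → F →L[ℝ] F →L[ℝ] F) (x v w : F) : F →ₗ[ℝ] F where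
  toFun u := connectionCurvature Γ x u v w
  map_add' u u' := by
    simp only [connectionCurvature, map_add, add_apply]
    abel
  map_smul' r u := by
    simp only [connectionCurvature, map_smul, smul_apply, RingHom.id_apply, smul_sub, smul_add]

/-- The pullback of the metric `h` by a map `φ` of vector spaces. -/
def pullbackForm (h : F → F →L[ℝ] F →L[ℝ] ℝ) (φ : E → F) (z : E) : LinearMap.BilinForm ℝ E :=
  LinearMap.mk₂ ℝ (fun v w => h (φ z) (fderiv ℝ φ z v) (fderiv ℝ φ z w))
    (by simp) (by simp) (by simp) (by simp)

@[simp] theorem pullbackForm_apply (h : F → F →L[ℝ] F →L[ℝ] ℝ) (φ : E → F) (z v w : E) :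
    pullbackForm h φ z v w = h (φ z) (fderiv ℝ φ z v) (fderiv ℝ φ z w) := rfl

/-- The covariant derivative `∇_v (dφ w) = Γ(dφ v, dφ w) + D²φ(v, w)` along `φ` of the constant
vector field `w`. If `φ` is a local isometry, this is the image under `dφ` of the Christoffel
symbol of the source. -/
def pullbackConnection (Γ : F → F →L[ℝ] F →L[ℝ] F) (φ : E → F) (z v w : E) : F :=
  Γ (φ z) (fderiv ℝ φ z v) (fderiv ℝ φ z w) + fderiv ℝ (fderiv ℝ φ) z v w

/-- `φ` is a local isometry from `g` to `h` near `y`. Three derivatives of `φ` suffice to compare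
the curvatures. -/
structure IsLocalIsometryAt (g : E → LinearMap.BilinForm ℝ E) (h : F → F →L[ℝ] F →L[ℝ] ℝ)
    (φ : E → F) (y : E) : Prop where
  contDiffAt : ContDiffAt ℝ 3 φ y
  isInvertible : (fderiv ℝ φ y).IsInvertible
  eventuallyEq : g =ᶠ[𝓝 y] pullbackForm h φ

theorem christoffel_eq_of_koszul (b : Basis ι ℝ E) {v w X : E} (hsymm : (g y).IsSymm)
    (hg : (g y).Nondegenerate)
    (hX : ∀ z, 2 * g y X z = fderiv ℝ (fun x => g x w z) y v + fderiv ℝ (fun x => g x v z) y w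
      - fderiv ℝ (fun x => g x v w) y z) :
    christoffel b g y v w = X := by
  conv_rhs => rw [← b.sum_repr X]
  unfold christoffel
  refine Finset.sum_congr rfl fun l _ => ?_
  rw [← Finset.sum_smul, ← sum_gram_inv_mul b hsymm hg X l]
  congr 1
  refine Finset.sum_congr rfl fun m _ => ?_
  rw [mul_assoc, ← hX (b m)]
  ring

theorem hasFDerivAt_fderiv_apply {z : E} (hφ : ContDiffAt ℝ 2 φ z) (v : E) :
    HasFDerivAt (fun x => fderiv ℝ φ x v) ((fderiv ℝ (fderiv ℝ φ) z).flip v) z := by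
  have hD : HasFDerivAt (fderiv ℝ φ) (fderiv ℝ (fderiv ℝ φ) z) z :=
    ((hφ.fderiv_right (m := 1) (by norm_num)).differentiableAt (by norm_num)).hasFDerivAt
  simpa using hD.clm_apply (hasFDerivAt_const v z)

theorem fderiv_pullbackForm (hφ : ContDiffAt ℝ 2 φ y) (hh : DifferentiableAt ℝ h (φ y))
    (u v w : E) :
    fderiv ℝ (fun x => pullbackForm h φ x v w) y u =
      fderiv ℝ h (φ y) (fderiv ℝ φ y u) (fderiv ℝ φ y v) (fderiv ℝ φ y w)
        + h (φ y) (fderiv ℝ (fderiv ℝ φ) y u v) (fderiv ℝ φ y w)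
        + h (φ y) (fderiv ℝ φ y v) (fderiv ℝ (fderiv ℝ φ) y u w) := by
  have hcomp : HasFDerivAt (fun x => h (φ x)) ((fderiv ℝ h (φ y)).comp (fderiv ℝ φ y)) y :=
    HasFDerivAt.comp (g := h) y hh.hasFDerivAt
      (hφ.differentiableAt (by norm_num)).hasFDerivAt
  have hform : HasFDerivAt (fun x => pullbackForm h φ x v w) _ y :=
    (hcomp.clm_apply (hasFDerivAt_fderiv_apply hφ v)).clm_apply (hasFDerivAt_fderiv_apply hφ w)
  rw [hform.fderiv]
  simp only [ContinuousLinearMap.coe_comp, Function.comp_apply, add_apply,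
    ContinuousLinearMap.flip_apply]
  ring

theorem hasFDerivAt_pullbackConnection (hφ : ContDiffAt ℝ 3 φ y)
    (hΓ : DifferentiableAt ℝ Γ (φ y)) (v w : E) :
    ∃ L : E →L[ℝ] F, HasFDerivAt (fun z => pullbackConnection Γ φ z v w) L y ∧
      ∀ u, L u = fderiv ℝ Γ (φ y) (fderiv ℝ φ y u) (fderiv ℝ φ y v) (fderiv ℝ φ y w)
        + Γ (φ y) (fderiv ℝ (fderiv ℝ φ) y u v) (fderiv ℝ φ y w)
        + Γ (φ y) (fderiv ℝ φ y v) (fderiv ℝ (fderiv ℝ φ) y u w)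
        + fderiv ℝ (fderiv ℝ (fderiv ℝ φ)) y u v w := by
  have hφ2 : ContDiffAt ℝ 2 φ y := hφ.of_le (by norm_num)
  have hcomp : HasFDerivAt (fun x => Γ (φ x)) ((fderiv ℝ Γ (φ y)).comp (fderiv ℝ φ y)) y :=
    HasFDerivAt.comp (g := Γ) y hΓ.hasFDerivAt
      (hφ.differentiableAt (by norm_num)).hasFDerivAt
  have hD : ContDiffAt ℝ 2 (fderiv ℝ φ) y := hφ.fderiv_right (by norm_num)
  have hDDv := hasFDerivAt_fderiv_apply hD v
  refine ⟨_, ((hcomp.clm_apply (hasFDerivAt_fderiv_apply hφ2 v)).clm_apply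
    (hasFDerivAt_fderiv_apply hφ2 w)).add (hDDv.clm_apply (hasFDerivAt_const w y)), fun u => ?_⟩
  simp only [ContinuousLinearMap.coe_comp, Function.comp_apply, add_apply,
    ContinuousLinearMap.flip_apply, zero_apply, map_zero, zero_add]
  abel

namespace IsLocalIsometryAt

theorem eventually (hφ : IsLocalIsometryAt g h φ y) [CompleteSpace E] :
    ∀ᶠ z in 𝓝 y, IsLocalIsometryAt g h φ z := by
  have hD : ContinuousAt (fderiv ℝ φ) y :=
    (hφ.contDiffAt.fderiv_right (m := 2) (by norm_num)).continuousAt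
  filter_upwards [hφ.contDiffAt.eventually (by simp), hφ.eventuallyEq.eventuallyEq_nhds,
    hD.eventually (ContinuousLinearEquiv.isOpen.mem_nhds hφ.isInvertible)] with z hz hgz hinv
  exact ⟨hz, hinv, hgz⟩

theorem isSymm (hφ : IsLocalIsometryAt g h φ y) (hΓ : IsLeviCivitaAt h Γ (φ y)) :
    (g y).IsSymm :=
  ⟨fun v w => by rw [hφ.eventuallyEq.self_of_nhds]; exact hΓ.symm _ _⟩

theorem nondegenerate (hφ : IsLocalIsometryAt g h φ y) (hΓ : IsLeviCivitaAt h Γ (φ y)) :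
    (g y).Nondegenerate := by
  have hleft (v : E) (hv : ∀ w, g y v w = 0) : v = 0 := by
    refine hφ.isInvertible.injective (.trans (hΓ.nondegenerate _ fun w => ?_) (map_zero _).symm)
    have := hv ((fderiv ℝ φ y).inverse w)
    rwa [hφ.eventuallyEq.self_of_nhds, pullbackForm_apply,
      hφ.isInvertible.self_apply_inverse] at this
  exact ⟨hleft, fun w hw => hleft w fun v => by rw [(hφ.isSymm hΓ).eq, hw]⟩

theorem fderiv_apply_christoffel (hφ : IsLocalIsometryAt g h φ y)
    (hΓ : IsLeviCivitaAt h Γ (φ y)) (v w : E) :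
    fderiv ℝ φ y (christoffel b g y v w) = pullbackConnection Γ φ y v w := by
  have hφ2 : ContDiffAt ℝ 2 φ y := hφ.contDiffAt.of_le (by norm_num)
  have hsymmD : IsSymmSndFDerivAt ℝ φ y := hφ2.isSymmSndFDerivAt (by simp)
  have hdg (u v w : E) : fderiv ℝ (fun x => g x v w) y u =
      fderiv ℝ (fun x => pullbackForm h φ x v w) y u := by
    rw [Filter.EventuallyEq.fderiv_eq (hφ.eventuallyEq.mono fun x hx => by rw [hx])]
  suffices hchr : christoffel b g y v w =
      (fderiv ℝ φ y).inverse (pullbackConnection Γ φ y v w) by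
    rw [hchr, hφ.isInvertible.self_apply_inverse]
  refine christoffel_eq_of_koszul b (hφ.isSymm hΓ) (hφ.nondegenerate hΓ) fun x => ?_
  simp only [hdg, fderiv_pullbackForm hφ2 hΓ.differentiableAt]
  rw [hφ.eventuallyEq.self_of_nhds, pullbackForm_apply, hφ.isInvertible.self_apply_inverse,
    pullbackConnection, map_add, add_apply, mul_add,
    hΓ.koszul (fderiv ℝ φ y v) (fderiv ℝ φ y w) (fderiv ℝ φ y x),
    hΓ.symm (fderiv ℝ φ y w) (fderiv ℝ (fderiv ℝ φ) y v x),
    hΓ.symm (fderiv ℝ φ y v) (fderiv ℝ (fderiv ℝ φ) y w x),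
    hΓ.symm (fderiv ℝ φ y v) (fderiv ℝ (fderiv ℝ φ) y x w),
    hsymmD.eq x v, hsymmD.eq x w, hsymmD.eq w v]
  ring

variable [CompleteSpace E]

theorem differentiableAt_christoffel (hφ : IsLocalIsometryAt g h φ y)
    (hΓ : ∀ᶠ x in 𝓝 (φ y), IsLeviCivitaAt h Γ x) (hdΓ : DifferentiableAt ℝ Γ (φ y)) (v w : E) :
    DifferentiableAt ℝ (fun z => christoffel b g z v w) y := by
  have heq : (fun z => christoffel b g z v w) =ᶠ[𝓝 y]
      fun z => (fderiv ℝ φ z).inverse (pullbackConnection Γ φ z v w) := by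
    filter_upwards [hφ.eventually, hφ.contDiffAt.continuousAt.eventually hΓ] with z hz hΓz
    rw [← hz.fderiv_apply_christoffel (b := b) hΓz, hz.isInvertible.inverse_apply_self]
  have hinv : DifferentiableAt ℝ (fun z => (fderiv ℝ φ z).inverse) y :=
    ((hφ.isInvertible.contDiffAt_map_inverse (n := 1)).differentiableAt (by norm_num)).comp y
      ((hφ.contDiffAt.fderiv_right (m := 1) (by norm_num)).differentiableAt (by norm_num))
  obtain ⟨L, hL, -⟩ := hasFDerivAt_pullbackConnection hφ.contDiffAt hdΓ v w
  exact (hinv.clm_apply hL.differentiableAt).congr_of_eventuallyEq heq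

theorem fderiv_apply_fderiv_christoffel (hφ : IsLocalIsometryAt g h φ y)
    (hΓ : ∀ᶠ x in 𝓝 (φ y), IsLeviCivitaAt h Γ x) (hdΓ : DifferentiableAt ℝ Γ (φ y))
    (u v w : E) :
    fderiv ℝ φ y (fderiv ℝ (fun z => christoffel b g z v w) y u) =
      fderiv ℝ (fun z => pullbackConnection Γ φ z v w) y u -
        fderiv ℝ (fderiv ℝ φ) y u (christoffel b g y v w) := by
  have heq : (fun z => fderiv ℝ φ z (christoffel b g z v w)) =ᶠ[𝓝 y]
      fun z => pullbackConnection Γ φ z v w := by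
    filter_upwards [hφ.eventually, hφ.contDiffAt.continuousAt.eventually hΓ] with z hz hΓz
    exact hz.fderiv_apply_christoffel hΓz v w
  have hD : HasFDerivAt (fderiv ℝ φ) (fderiv ℝ (fderiv ℝ φ) y) y :=
    ((hφ.contDiffAt.fderiv_right (m := 1) (by norm_num)).differentiableAt
      (by norm_num)).hasFDerivAt
  rw [← heq.fderiv_eq,
    (hD.clm_apply (hφ.differentiableAt_christoffel hΓ hdΓ v w).hasFDerivAt).fderiv]
  simp

theorem fderiv_apply_localCurvature (hφ : IsLocalIsometryAt g h φ y)
    (hΓ : ∀ᶠ x in 𝓝 (φ y), IsLeviCivitaAt h Γ x) (hdΓ : DifferentiableAt ℝ Γ (φ y))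
    (u v w : E) :
    fderiv ℝ φ y (localCurvature b g y u v w) =
      connectionCurvature Γ (φ y) (fderiv ℝ φ y u) (fderiv ℝ φ y v) (fderiv ℝ φ y w) := by
  have hD : ContDiffAt ℝ 2 (fderiv ℝ φ) y := hφ.contDiffAt.fderiv_right (by norm_num)
  have hsymmD : IsSymmSndFDerivAt ℝ φ y :=
    (hφ.contDiffAt.of_le (m := 2) (by norm_num)).isSymmSndFDerivAt (by simp)
  have hsymmDD : IsSymmSndFDerivAt ℝ (fderiv ℝ φ) y := hD.isSymmSndFDerivAt (by simp)
  have hfirst (v w : E) : fderiv ℝ φ y (christoffel b g y v w) = pullbackConnection Γ φ y v w :=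
    hφ.fderiv_apply_christoffel hΓ.self_of_nhds v w
  have hsecond (u v w : E) : pullbackConnection Γ φ y u (christoffel b g y v w) =
      Γ (φ y) (fderiv ℝ φ y u) (Γ (φ y) (fderiv ℝ φ y v) (fderiv ℝ φ y w)) +
      Γ (φ y) (fderiv ℝ φ y u) (fderiv ℝ (fderiv ℝ φ) y v w) +
      fderiv ℝ (fderiv ℝ φ) y u (christoffel b g y v w) := by
    rw [pullbackConnection, hfirst, pullbackConnection, map_add]
  obtain ⟨Lv, hLv, hLv_apply⟩ := hasFDerivAt_pullbackConnection hφ.contDiffAt hdΓ v w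
  obtain ⟨Lu, hLu, hLu_apply⟩ := hasFDerivAt_pullbackConnection hφ.contDiffAt hdΓ u w
  simp only [localCurvature, connectionCurvature, map_add, map_sub, hfirst, hsecond,
    hφ.fderiv_apply_fderiv_christoffel hΓ hdΓ, hLv.fderiv, hLu.fderiv, hLv_apply, hLu_apply]
  rw [hsymmD.eq u v, hsymmDD.eq u v]
  abel

end IsLocalIsometryAt

omit [DecidableEq ι] in
theorem trace_eq_sum_coord (b : Basis ι ℝ E) (L : E →ₗ[ℝ] E) :
    LinearMap.trace ℝ E L = ∑ i, b.coord i (L (b i)) := by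
  classical
  rw [LinearMap.trace_eq_matrix_trace ℝ b]
  simp [Matrix.trace, LinearMap.toMatrix_apply]

theorem IsLocalIsometryAt.localRicci_eq [CompleteSpace E] (hφ : IsLocalIsometryAt g h φ y)
    (hΓ : ∀ᶠ x in 𝓝 (φ y), IsLeviCivitaAt h Γ x) (hdΓ : DifferentiableAt ℝ Γ (φ y)) (v w : E) :
    localRicci b g y v w =
      LinearMap.trace ℝ F (ricciOperator Γ (φ y) (fderiv ℝ φ y v) (fderiv ℝ φ y w)) := by
  obtain ⟨e, he⟩ := id hφ.isInvertible
  rw [← LinearMap.trace_conj' _ e.symm.toLinearEquiv, trace_eq_sum_coord b]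
  refine Finset.sum_congr rfl fun i _ => congrArg _ ?_
  have hcurv := hφ.fderiv_apply_localCurvature (b := b) hΓ hdΓ (b i) v w
  rw [← he] at hcurv ⊢
  exact (e.symm_apply_eq.2 hcurv.symm).symm

/-- `T` is the Ricci endomorphism of `h`, obtained from the Ricci form by raising an index. -/
theorem IsLocalIsometryAt.localScalarCurvature_eq_trace [CompleteSpace E]
    (hφ : IsLocalIsometryAt g h φ y)
    (hΓ : ∀ᶠ x in 𝓝 (φ y), IsLeviCivitaAt h Γ x) (hdΓ : DifferentiableAt ℝ Γ (φ y))
    {T : F →ₗ[ℝ] F}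
    (hT : ∀ v w, LinearMap.trace ℝ F (ricciOperator Γ (φ y) v w) = h (φ y) (T v) w) :
    localScalarCurvature b g y = LinearMap.trace ℝ F T := by
  obtain ⟨e, he⟩ := id hφ.isInvertible
  rw [← LinearMap.trace_conj' T e.symm.toLinearEquiv, trace_eq_sum_coord b]
  refine Finset.sum_congr rfl fun i _ => ?_
  rw [Basis.coord_apply,
    ← sum_gram_inv_mul b (hφ.isSymm hΓ.self_of_nhds) (hφ.nondegenerate hΓ.self_of_nhds)]
  refine Finset.sum_congr rfl fun j _ => ?_
  rw [hφ.localRicci_eq hΓ hdΓ, hT, hφ.eventuallyEq.self_of_nhds, pullbackForm_apply, ← he]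
  congr 3
  exact (e.apply_symm_apply _).symm

end LeviCivita

/-! ### Products of conformally flat metrics -/

section ConformallyFlat

set_option maxSynthPendingDepth 3

open scoped Topology InnerProductSpace

variable {V : Type*} [NormedAddCommGroup V] [InnerProductSpace ℝ V]
  {W : Type*} [NormedAddCommGroup W] [InnerProductSpace ℝ W]

/-- The inner product as a continuous bilinear form, without the conjugation in `innerSL`. -/
def realInner (V : Type*) [NormedAddCommGroup V] [InnerProductSpace ℝ V] : V →L[ℝ] V →L[ℝ] ℝ :=
  (isBoundedBilinearMap_inner (𝕜 := ℝ)).toContinuousLinearMap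

@[simp] theorem realInner_apply (v w : V) : realInner V v w = ⟪v, w⟫_ℝ := rfl

/-- The form `(v,w) ↦ ⟨a,v⟩w + ⟨a,w⟩v - ⟨v,w⟩a`, linear in `a`; it is the Levi-Civita connection
of the metric `e^{2f}⟨·,·⟩` if `a` is the gradient of `f`. -/
def conformalConnection (V : Type*) [NormedAddCommGroup V] [InnerProductSpace ℝ V] :
    V →L[ℝ] V →L[ℝ] V →L[ℝ] V :=
  let T : V →L[ℝ] V →L[ℝ] V →L[ℝ] V :=
    ((ContinuousLinearMap.smulRightL ℝ V (V →L[ℝ] V)).flip (ContinuousLinearMap.id ℝ V)).comp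
      (realInner V)
  T + (ContinuousLinearMap.flipₗᵢ ℝ V V V : (V →L[ℝ] V →L[ℝ] V) →L[ℝ] _).comp T
    - ((ContinuousLinearMap.compL ℝ V (V →L[ℝ] ℝ) (V →L[ℝ] V)).flip (realInner V)).comp
      (ContinuousLinearMap.smulRightL ℝ V V).flip

theorem conformalConnection_apply (a v w : V) :
    conformalConnection V a v w = ⟪a, v⟫_ℝ • w + ⟪a, w⟫_ℝ • v - ⟪v, w⟫_ℝ • a := by
  simp [conformalConnection]

/-- The metric `c⟨·,·⟩` has gradient field `a = ∇(log c)/2` at `x`. -/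
structure IsConformalFactorAt (c : V → ℝ) (a : V → V) (x : V) : Prop where
  pos : 0 < c x
  hasFDerivAt : HasFDerivAt c ((2 * c x) • realInner V (a x)) x

/-- The metric `c⟨·,·⟩` has constant curvature `κ` at `x`, expressed by its gradient field `a`. -/
def HasCurvatureAt (c : V → ℝ) (a : V → V) (κ : ℝ) (x : V) : Prop :=
  ∃ l : ℝ, HasFDerivAt a ((realInner V (a x)).smulRight (a x) - l • ContinuousLinearMap.id ℝ V) x ∧
    2 * l - ⟪a x, a x⟫_ℝ = κ * c x

theorem conformalConnection_curvature (a u v w : V) (l : ℝ) :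
    conformalConnection V (⟪a, u⟫_ℝ • a - l • u) v w
      - conformalConnection V (⟪a, v⟫_ℝ • a - l • v) u w
      + conformalConnection V a u (conformalConnection V a v w)
      - conformalConnection V a v (conformalConnection V a u w)
    = (2 * l - ⟪a, a⟫_ℝ) • (⟪v, w⟫_ℝ • u - ⟪u, w⟫_ℝ • v) := by
  simp only [conformalConnection_apply, inner_sub_left, inner_smul_left,
    inner_add_right, inner_sub_right, inner_smul_right, real_inner_comm a, real_inner_comm u v,
    RCLike.conj_to_real]
  module

/-- The metric `c₁⟨·,·⟩ ⊕ c₂⟨·,·⟩` on `V × W`. -/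
def conformalProd (c₁ : V → ℝ) (c₂ : W → ℝ) (x : V × W) : (V × W) →L[ℝ] (V × W) →L[ℝ] ℝ :=
  c₁ x.1 • (realInner V).bilinearComp (.fst ℝ V W) (.fst ℝ V W) +
    c₂ x.2 • (realInner W).bilinearComp (.snd ℝ V W) (.snd ℝ V W)

theorem conformalProd_apply (c₁ : V → ℝ) (c₂ : W → ℝ) (x v w : V × W) :
    conformalProd c₁ c₂ x v w = c₁ x.1 * ⟪v.1, w.1⟫_ℝ + c₂ x.2 * ⟪v.2, w.2⟫_ℝ := by
  simp [conformalProd]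

/-- The bilinear map `(v, w) ↦ i (B (π v) (π w))`, linear in `B`. It extends a vector-valued
bilinear map on a direct summand, with projection `π` and inclusion `i`, by zero. -/
def extendBilin {E : Type*} [NormedAddCommGroup E] [NormedSpace ℝ E] (π : E →L[ℝ] V)
    (i : V →L[ℝ] E) : (V →L[ℝ] V →L[ℝ] V) →L[ℝ] E →L[ℝ] E →L[ℝ] E :=
  (ContinuousLinearMap.compL ℝ E (V →L[ℝ] V) (E →L[ℝ] E)
    ((ContinuousLinearMap.compL ℝ E V E i).comp
      ((ContinuousLinearMap.compL ℝ E V V).flip π))).comp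
    ((ContinuousLinearMap.compL ℝ E V (V →L[ℝ] V)).flip π)

theorem extendBilin_apply {E : Type*} [NormedAddCommGroup E] [NormedSpace ℝ E] (π : E →L[ℝ] V)
    (i : V →L[ℝ] E) (B : V →L[ℝ] V →L[ℝ] V) (v w : E) :
    extendBilin π i B v w = i (B (π v) (π w)) := by
  simp [extendBilin]

/-- The Levi-Civita connection of `c₁⟨·,·⟩ ⊕ c₂⟨·,·⟩`, where `aᵢ = ∇(log cᵢ)/2`. -/
def conformalProdConnection (a₁ : V → V) (a₂ : W → W) (x : V × W) :
    (V × W) →L[ℝ] (V × W) →L[ℝ] V × W :=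
  extendBilin (.fst ℝ V W) (.inl ℝ V W) (conformalConnection V (a₁ x.1)) +
    extendBilin (.snd ℝ V W) (.inr ℝ V W) (conformalConnection W (a₂ x.2))

theorem conformalProdConnection_apply (a₁ : V → V) (a₂ : W → W) (x v w : V × W) :
    conformalProdConnection a₁ a₂ x v w =
      (conformalConnection V (a₁ x.1) v.1 w.1, conformalConnection W (a₂ x.2) v.2 w.2) := by
  simp [conformalProdConnection, extendBilin_apply]

variable {c₁ : V → ℝ} {c₂ : W → ℝ} {a₁ : V → V} {a₂ : W → W} {κ₁ κ₂ : ℝ} {x : V × W}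

theorem eq_zero_of_conformalProd_self (hc₁ : 0 < c₁ x.1) (hc₂ : 0 < c₂ x.2) {v : V × W}
    (hv : conformalProd c₁ c₂ x v v = 0) : v = 0 := by
  rw [conformalProd_apply] at hv
  obtain ⟨hv₁, hv₂⟩ := (add_eq_zero_iff_of_nonneg
    (mul_nonneg hc₁.le real_inner_self_nonneg) (mul_nonneg hc₂.le real_inner_self_nonneg)).1 hv
  exact Prod.ext (inner_self_eq_zero.1 ((mul_eq_zero_iff_left hc₁.ne').1 hv₁))
    (inner_self_eq_zero.1 ((mul_eq_zero_iff_left hc₂.ne').1 hv₂))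

theorem isLeviCivitaAt_conformalProd (h₁ : IsConformalFactorAt c₁ a₁ x.1)
    (h₂ : IsConformalFactorAt c₂ a₂ x.2) :
    IsLeviCivitaAt (conformalProd c₁ c₂) (conformalProdConnection a₁ a₂) x := by
  have hd₁ : HasFDerivAt (fun y : V × W => c₁ y.1) _ x :=
    HasFDerivAt.comp (g := c₁) x h₁.hasFDerivAt hasFDerivAt_fst
  have hd₂ : HasFDerivAt (fun y : V × W => c₂ y.2) _ x :=
    HasFDerivAt.comp (g := c₂) x h₂.hasFDerivAt hasFDerivAt_snd
  have hd : HasFDerivAt (conformalProd c₁ c₂) _ x :=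
    (hd₁.smul_const ((realInner V).bilinearComp (.fst ℝ V W) (.fst ℝ V W))).add
      (hd₂.smul_const ((realInner W).bilinearComp (.snd ℝ V W) (.snd ℝ V W)))
  refine ⟨fun v w => ?_, fun v hv => eq_zero_of_conformalProd_self h₁.pos h₂.pos (hv v),
    hd.differentiableAt, fun v w z => ?_⟩
  · rw [conformalProd_apply, conformalProd_apply, real_inner_comm v.1, real_inner_comm v.2]
  · rw [conformalProd_apply, conformalProdConnection_apply, hd.fderiv]
    simp [inner_add_left, inner_sub_left, inner_smul_left, conformalConnection_apply]
    ring

theorem hasFDerivAt_conformalProdConnection {A₁ : V →L[ℝ] V} {A₂ : W →L[ℝ] W}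
    (h₁ : HasFDerivAt a₁ A₁ x.1) (h₂ : HasFDerivAt a₂ A₂ x.2) :
    HasFDerivAt (conformalProdConnection a₁ a₂)
      (((extendBilin (.fst ℝ V W) (.inl ℝ V W)).comp (conformalConnection V)).comp
          (A₁.comp (.fst ℝ V W)) +
        ((extendBilin (.snd ℝ V W) (.inr ℝ V W)).comp (conformalConnection W)).comp
          (A₂.comp (.snd ℝ V W))) x := by
  have hd₁ : HasFDerivAt (fun y : V × W => a₁ y.1) (A₁.comp (.fst ℝ V W)) x :=
    HasFDerivAt.comp (g := a₁) x h₁ hasFDerivAt_fst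
  have hd₂ : HasFDerivAt (fun y : V × W => a₂ y.2) (A₂.comp (.snd ℝ V W)) x :=
    HasFDerivAt.comp (g := a₂) x h₂ hasFDerivAt_snd
  exact (HasFDerivAt.comp (g := (extendBilin (.fst ℝ V W) (.inl ℝ V W)).comp
      (conformalConnection V)) x (ContinuousLinearMap.hasFDerivAt _) hd₁).add
    (HasFDerivAt.comp (g := (extendBilin (.snd ℝ V W) (.inr ℝ V W)).comp
      (conformalConnection W)) x (ContinuousLinearMap.hasFDerivAt _) hd₂)

theorem connectionCurvature_conformalProd (h₁ : HasCurvatureAt c₁ a₁ κ₁ x.1)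
    (h₂ : HasCurvatureAt c₂ a₂ κ₂ x.2) (u v w : V × W) :
    connectionCurvature (conformalProdConnection a₁ a₂) x u v w =
      ((κ₁ * c₁ x.1) • (⟪v.1, w.1⟫_ℝ • u.1 - ⟪u.1, w.1⟫_ℝ • v.1),
        (κ₂ * c₂ x.2) • (⟪v.2, w.2⟫_ℝ • u.2 - ⟪u.2, w.2⟫_ℝ • v.2)) := by
  obtain ⟨l₁, hd₁, hl₁⟩ := h₁
  obtain ⟨l₂, hd₂, hl₂⟩ := h₂
  rw [connectionCurvature, (hasFDerivAt_conformalProdConnection hd₁ hd₂).fderiv, ← hl₁, ← hl₂,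
    ← conformalConnection_curvature, ← conformalConnection_curvature]
  ext <;> simp [conformalProdConnection_apply, extendBilin_apply]

/-- The Ricci endomorphism of a product of two metrics of constant curvature. -/
def ricciEndomorphism (V W : Type*) [NormedAddCommGroup V] [InnerProductSpace ℝ V]
    [NormedAddCommGroup W] [InnerProductSpace ℝ W] (κ₁ κ₂ : ℝ) : V × W →ₗ[ℝ] V × W :=
  ((κ₁ * (finrank ℝ V - 1)) • LinearMap.id).prodMap ((κ₂ * (finrank ℝ W - 1)) • LinearMap.id)

variable [FiniteDimensional ℝ V] [FiniteDimensional ℝ W]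

theorem trace_ricciOperator_conformalProd (h₁ : HasCurvatureAt c₁ a₁ κ₁ x.1)
    (h₂ : HasCurvatureAt c₂ a₂ κ₂ x.2) (v w : V × W) :
    LinearMap.trace ℝ (V × W) (ricciOperator (conformalProdConnection a₁ a₂) x v w) =
      conformalProd c₁ c₂ x (ricciEndomorphism V W κ₁ κ₂ v) w := by
  have hRic : ricciOperator (conformalProdConnection a₁ a₂) x v w =
      ((κ₁ * c₁ x.1) • (⟪v.1, w.1⟫_ℝ • (LinearMap.id : V →ₗ[ℝ] V) -
        ((innerₗ V).flip w.1).smulRight v.1)).prodMap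
      ((κ₂ * c₂ x.2) • (⟪v.2, w.2⟫_ℝ • (LinearMap.id : W →ₗ[ℝ] W) -
        ((innerₗ W).flip w.2).smulRight v.2)) :=
    LinearMap.ext fun u => connectionCurvature_conformalProd h₁ h₂ u v w
  rw [hRic, LinearMap.trace_prodMap', conformalProd_apply]
  simp [LinearMap.trace_smulRight, inner_smul_left, ricciEndomorphism, real_inner_comm v.1,
    real_inner_comm v.2]
  ring

theorem localScalarCurvature_of_isLocalIsometryAt_conformalProd
    {E : Type*} [NormedAddCommGroup E] [NormedSpace ℝ E] [CompleteSpace E]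
    {ι : Type*} [Fintype ι] [DecidableEq ι] {b : Basis ι ℝ E}
    {g : E → LinearMap.BilinForm ℝ E} {φ : E → V × W} {y : E}
    (hφ : IsLocalIsometryAt g (conformalProd c₁ c₂) φ y)
    (h₁ : ∀ᶠ x in 𝓝 (φ y).1, IsConformalFactorAt c₁ a₁ x)
    (h₂ : ∀ᶠ x in 𝓝 (φ y).2, IsConformalFactorAt c₂ a₂ x)
    (hκ₁ : HasCurvatureAt c₁ a₁ κ₁ (φ y).1) (hκ₂ : HasCurvatureAt c₂ a₂ κ₂ (φ y).2) :
    localScalarCurvature b g y = κ₁ * (finrank ℝ V - 1) * finrank ℝ V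
      + κ₂ * (finrank ℝ W - 1) * finrank ℝ W := by
  have hΓ : ∀ᶠ x in 𝓝 (φ y),
      IsLeviCivitaAt (conformalProd c₁ c₂) (conformalProdConnection a₁ a₂) x := by
    filter_upwards [continuousAt_fst.eventually h₁, continuousAt_snd.eventually h₂] with x hx₁ hx₂
    exact isLeviCivitaAt_conformalProd hx₁ hx₂
  have hdΓ : DifferentiableAt ℝ (conformalProdConnection a₁ a₂) (φ y) := by
    obtain ⟨_, hd₁, -⟩ := hκ₁
    obtain ⟨_, hd₂, -⟩ := hκ₂
    exact (hasFDerivAt_conformalProdConnection hd₁ hd₂).differentiableAt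
  rw [hφ.localScalarCurvature_eq_trace hΓ hdΓ (trace_ricciOperator_conformalProd hκ₁ hκ₂),
    ricciEndomorphism, LinearMap.trace_prodMap']
  simp

end ConformallyFlat

/-! ### The conformal factors of the round and the hyperbolic metric -/

section ConformalFactors

open scoped InnerProductSpace

variable {V : Type*} [NormedAddCommGroup V] [InnerProductSpace ℝ V]
  {W : Type*} [NormedAddCommGroup W] [InnerProductSpace ℝ W]

/-- The conformal factor of the round metric in stereographic coordinates, where the sphere is
projected from a pole to the hyperplane through the opposite pole at distance `2`. -/
def roundFactor (x : V) : ℝ := 16 / (‖x‖ ^ 2 + 4) ^ 2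

/-- Half the gradient of the logarithm of `roundFactor`. -/
def roundGradient (x : V) : V := (-2 / (‖x‖ ^ 2 + 4)) • x

theorem hasFDerivAt_norm_sq_add_four (x : V) :
    HasFDerivAt (fun y : V => ‖y‖ ^ 2 + 4) ((2 : ℝ) • realInner V x) x := by
  refine (((hasStrictFDerivAt_norm_sq x).hasFDerivAt).add_const 4).congr_fderiv ?_
  ext v
  simp

theorem hasFDerivAt_inv_norm_sq_add_four (x : V) :
    HasFDerivAt (fun y : V => (‖y‖ ^ 2 + 4)⁻¹)
      ((-((‖x‖ ^ 2 + 4) ^ 2)⁻¹) • (2 : ℝ) • realInner V x) x :=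
  (hasDerivAt_inv (by positivity)).comp_hasFDerivAt x (hasFDerivAt_norm_sq_add_four x)

theorem isConformalFactorAt_round (x : V) : IsConformalFactorAt roundFactor roundGradient x where
  pos := by unfold roundFactor; positivity
  hasFDerivAt := by
    have hq : ‖x‖ ^ 2 + 4 ≠ 0 := by positivity
    have hfactor : (fun y : V => 16 * (‖y‖ ^ 2 + 4)⁻¹ ^ 2) = roundFactor := by
      funext y
      rw [roundFactor, inv_pow, div_eq_mul_inv]
    rw [← hfactor]
    refine (((hasFDerivAt_inv_norm_sq_add_four x).pow 2).const_mul 16).congr_fderiv ?_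
    ext v
    simp only [roundGradient, smul_smul, smul_apply, realInner_apply,
      inner_smul_left, RCLike.conj_to_real, smul_eq_mul, nsmul_eq_mul, Nat.cast_ofNat, pow_one,
      Nat.add_one_sub_one]
    field_simp

theorem hasCurvatureAt_round (x : V) : HasCurvatureAt roundFactor roundGradient 1 x := by
  have hq : ‖x‖ ^ 2 + 4 ≠ 0 := by positivity
  refine ⟨2 / (‖x‖ ^ 2 + 4), ?_, ?_⟩
  · refine (((hasFDerivAt_inv_norm_sq_add_four x).const_mul (-2)).smul
      (hasFDerivAt_id x)).congr_fderiv ?_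
    ext v
    simp only [roundGradient, smul_smul, add_apply,
      sub_apply, smul_apply,
      ContinuousLinearMap.smulRight_apply, ContinuousLinearMap.id_apply, realInner_apply,
      inner_smul_left, RCLike.conj_to_real, smul_eq_mul, id_eq]
    match_scalars <;> field_simp
  · simp only [roundGradient, roundFactor, inner_smul_left, inner_smul_right,
      real_inner_self_eq_norm_sq, RCLike.conj_to_real]
    field_simp
    ring

theorem fderiv_stereoInvFunAux_comp (U : W →ₗᵢ[ℝ] V) (n : V) (y v : W) :
    fderiv ℝ (fun x => stereoInvFunAux n (U x)) y v =
      (4 / (‖y‖ ^ 2 + 4)) • U v - (8 * ⟪y, v⟫_ℝ / (‖y‖ ^ 2 + 4) ^ 2) • U y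
        + (16 * ⟪y, v⟫_ℝ / (‖y‖ ^ 2 + 4) ^ 2) • n := by
  have hq : ‖y‖ ^ 2 + 4 ≠ 0 := by positivity
  have hfun : (fun x => stereoInvFunAux n (U x)) =
      fun x => (‖x‖ ^ 2 + 4)⁻¹ • ((4 : ℝ) • U x + (‖x‖ ^ 2 + 4 - 8) • n) := by
    funext x
    rw [stereoInvFunAux_apply, U.norm_map]
    congr 3
    ring
  have hlin : HasFDerivAt (fun x : W => (4 : ℝ) • U x) ((4 : ℝ) • U.toContinuousLinearMap) y :=
    U.toContinuousLinearMap.hasFDerivAt.const_smul (4 : ℝ)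
  have hpole : HasFDerivAt (fun x : W => (‖x‖ ^ 2 + 4 - 8) • n)
      (((2 : ℝ) • realInner W y).smulRight n) y :=
    ((hasFDerivAt_norm_sq_add_four y).sub_const 8).smul_const n
  rw [hfun, ((hasFDerivAt_inv_norm_sq_add_four y).fun_smul (hlin.fun_add hpole)).fderiv]
  simp only [smul_smul, add_apply, smul_apply,
    ContinuousLinearMap.smulRight_apply, realInner_apply, LinearIsometry.coe_toContinuousLinearMap,
    smul_eq_mul, smul_add]
  match_scalars <;> field_simp <;> ring

theorem inner_fderiv_stereoInvFunAux_comp (U : W →ₗᵢ[ℝ] V) {n : V} (hn : ‖n‖ = 1)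
    (hU : ∀ w, ⟪n, U w⟫_ℝ = 0) (y v w : W) :
    ⟪fderiv ℝ (fun x => stereoInvFunAux n (U x)) y v,
      fderiv ℝ (fun x => stereoInvFunAux n (U x)) y w⟫_ℝ = roundFactor y * ⟪v, w⟫_ℝ := by
  have hq : ‖y‖ ^ 2 + 4 ≠ 0 := by positivity
  have hU' (w : W) : ⟪U w, n⟫_ℝ = 0 := by rw [real_inner_comm, hU]
  rw [fderiv_stereoInvFunAux_comp, fderiv_stereoInvFunAux_comp]
  simp only [inner_add_left, inner_sub_left, inner_smul_left, inner_add_right, inner_sub_right,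
    inner_smul_right, U.inner_map_map, hU, hU', real_inner_self_eq_norm_sq, hn,
    RCLike.conj_to_real, real_inner_comm y v, roundFactor]
  field_simp
  ring

section Hyperbolic

variable {k : ℕ} {x : EuclideanSpace ℝ (Fin (k + 1))}

/-- The conformal factor of the hyperbolic metric in the upper half-space. -/
def hyperbolicFactor (x : EuclideanSpace ℝ (Fin (k + 1))) : ℝ := 1 / (x 0) ^ 2

/-- Half the gradient of the logarithm of `hyperbolicFactor`. -/
def hyperbolicGradient (x : EuclideanSpace ℝ (Fin (k + 1))) : EuclideanSpace ℝ (Fin (k + 1)) :=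
  (-(x 0)⁻¹) • EuclideanSpace.single 0 1

theorem hasFDerivAt_inv_apply_zero (hx : 0 < x 0) :
    HasFDerivAt (fun y : EuclideanSpace ℝ (Fin (k + 1)) => (y 0)⁻¹)
      ((-(x 0 ^ 2)⁻¹) • (EuclideanSpace.proj 0 : EuclideanSpace ℝ (Fin (k + 1)) →L[ℝ] ℝ)) x :=
  (hasDerivAt_inv hx.ne').comp_hasFDerivAt x
    (EuclideanSpace.proj 0 : EuclideanSpace ℝ (Fin (k + 1)) →L[ℝ] ℝ).hasFDerivAt

theorem isConformalFactorAt_hyperbolic (hx : 0 < x 0) :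
    IsConformalFactorAt hyperbolicFactor hyperbolicGradient x where
  pos := by unfold hyperbolicFactor; positivity
  hasFDerivAt := by
    have hfactor : (fun y : EuclideanSpace ℝ (Fin (k + 1)) => (y 0)⁻¹ ^ 2) =
        hyperbolicFactor := by
      funext y
      rw [hyperbolicFactor, inv_pow, one_div]
    rw [← hfactor]
    refine ((hasFDerivAt_inv_apply_zero hx).pow 2).congr_fderiv ?_
    ext v
    simp only [hyperbolicGradient, smul_apply, realInner_apply,
      inner_smul_left, EuclideanSpace.inner_single_left, RCLike.conj_to_real, map_one, one_mul,
      PiLp.proj_apply, smul_eq_mul, nsmul_eq_mul, Nat.cast_ofNat, pow_one, Nat.add_one_sub_one]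
    field_simp

theorem hasCurvatureAt_hyperbolic (hx : 0 < x 0) :
    HasCurvatureAt hyperbolicFactor hyperbolicGradient (-1) x := by
  refine ⟨0, ?_, ?_⟩
  · refine ((hasFDerivAt_inv_apply_zero hx).fun_neg.smul_const
      (EuclideanSpace.single 0 1 : EuclideanSpace ℝ (Fin (k + 1)))).congr_fderiv ?_
    ext v : 1
    simp only [hyperbolicGradient, neg_apply,
      smul_apply, ContinuousLinearMap.smulRight_apply, realInner_apply,
      inner_smul_left, EuclideanSpace.inner_single_left, RCLike.conj_to_real, map_one, one_mul,
      PiLp.proj_apply, smul_eq_mul, zero_smul, sub_zero, smul_smul]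
    congr 1
    field_simp
  · simp [hyperbolicGradient, hyperbolicFactor, norm_smul]

end Hyperbolic

end ConformalFactors

/-! ### Metrics in charts -/

section Charts

open scoped Topology

variable {E : Type*} [NormedAddCommGroup E] [NormedSpace ℝ E]
  {H : Type*} [TopologicalSpace H] {I : ModelWithCorners ℝ E H}
  {M : Type*} [TopologicalSpace M] [ChartedSpace H M]
  {F : Type*} [NormedAddCommGroup F] [NormedSpace ℝ F]
  {G : Type*} [TopologicalSpace G] {J : ModelWithCorners ℝ F G}
  {N : Type*} [TopologicalSpace N] [ChartedSpace G N]
  {E' : Type*} [NormedAddCommGroup E'] [NormedSpace ℝ E']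
  {H' : Type*} [TopologicalSpace H'] {K : ModelWithCorners ℝ E' H'}
  {P : Type*} [TopologicalSpace P] [ChartedSpace H' P]

namespace TwoTensor

theorem pullback_apply (g : TwoTensor J N) (f : M → N) (x : M) (v w : TangentSpace I x) :
    TwoTensor.pullback I g f x v w = g (f x) (mfderiv I J f x v) (mfderiv I J f x w) := rfl

theorem pullback_comp (g : TwoTensor K P) {f : N → P} {h : M → N} {x : M}
    (hf : MDifferentiableAt J K f (h x)) (hh : MDifferentiableAt I J h x) :
    TwoTensor.pullback I g (f ∘ h) x = TwoTensor.pullback I (TwoTensor.pullback J g f) h x := by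
  refine LinearMap.ext₂ fun v w => ?_
  rw [pullback_apply, pullback_apply, pullback_apply, mfderiv_comp x hf hh]
  rfl

theorem pullback_congr (g : TwoTensor J N) {f f' : M → N} {x : M} (h : f =ᶠ[𝓝 x] f') :
    TwoTensor.pullback I g f x = TwoTensor.pullback I g f' x := by
  unfold TwoTensor.pullback
  rw [h.mfderiv_eq, h.self_of_nhds]

theorem prod_apply (g : TwoTensor I M) (h : TwoTensor J N) (p : M × N)
    (v w : TangentSpace (I.prod J) p) : g.prod h p v w = g p.1 v.1 w.1 + h p.2 v.2 w.2 := by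
  simp only [TwoTensor.prod, LinearMap.add_apply, pullback_apply, mfderiv_fst, mfderiv_snd]
  rfl

theorem isInnerProduct_prod {g : TwoTensor I M} {h : TwoTensor J N}
    (hg : ∀ x, IsInnerProduct (g x)) (hh : ∀ y, IsInnerProduct (h y)) (p : M × N) :
    IsInnerProduct (g.prod h p) := by
  have hprod : g.prod h p = (g p.1).compl₁₂ (LinearMap.fst ℝ E F) (LinearMap.fst ℝ E F) +
      (h p.2).compl₁₂ (LinearMap.snd ℝ E F) (LinearMap.snd ℝ E F) :=
    LinearMap.ext₂ (prod_apply g h p)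
  rw [hprod]
  exact (hg p.1).compl₁₂_fst_add_compl₁₂_snd (hh p.2)

end TwoTensor

section ChartInverse

variable [I.Boundaryless] [IsManifold I ∞ M]

theorem contMDiffAt_extChartAt_symm_of_mem_target {x : M} {y : E}
    (hy : y ∈ (extChartAt I x).target) : ContMDiffAt 𝓘(ℝ, E) I ∞ (extChartAt I x).symm y :=
  (contMDiffOn_extChartAt_symm x).contMDiffAt ((isOpen_extChartAt_target x).mem_nhds hy)

theorem mdifferentiableAt_extChartAt_symm {x : M} {y : E} (hy : y ∈ (extChartAt I x).target) :
    MDifferentiableAt 𝓘(ℝ, E) I (extChartAt I x).symm y :=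
  (contMDiffAt_extChartAt_symm_of_mem_target hy).mdifferentiableAt (by simp)

theorem isInvertible_mfderiv_extChartAt_symm {x : M} {y : E} (hy : y ∈ (extChartAt I x).target) :
    (mfderiv 𝓘(ℝ, E) I (extChartAt I x).symm y).IsInvertible := by
  have : IsManifold I 1 M := .of_le (n := ∞) (by simp)
  simpa only [ModelWithCorners.range_eq_univ, mfderivWithin_univ] using
    isInvertible_mfderivWithin_extChartAt_symm hy

theorem isInnerProduct_chartCoefficients {g : TwoTensor I M}
    (hg : ∀ x, IsInnerProduct (g x)) (x : M) {y : E} (hy : y ∈ (extChartAt I x).target) :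
    IsInnerProduct (chartCoefficients g x y) :=
  (hg _).compl₁₂ (isInvertible_mfderiv_extChartAt_symm hy).injective

end ChartInverse

theorem chartCoefficients_prod [I.Boundaryless] [J.Boundaryless] [IsManifold I ∞ M]
    [IsManifold J ∞ N] (g : TwoTensor I M) (h : TwoTensor J N) (p : M × N) {y : E × F}
    (hy₁ : y.1 ∈ (extChartAt I p.1).target) (hy₂ : y.2 ∈ (extChartAt J p.2).target)
    (v w : E × F) :
    chartCoefficients (g.prod h) p y v w =
      chartCoefficients g p.1 y.1 v.1 w.1 + chartCoefficients h p.2 y.2 v.2 w.2 := by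
  have hsymm : ((extChartAt (I.prod J) p).symm : E × F → M × N) =
      Prod.map (extChartAt I p.1).symm (extChartAt J p.2).symm := by
    rw [extChartAt_prod]
    rfl
  have hderiv : mfderiv 𝓘(ℝ, E × F) (I.prod J) (extChartAt (I.prod J) p).symm y =
      (mfderiv 𝓘(ℝ, E) I (extChartAt I p.1).symm y.1).prodMap
        (mfderiv 𝓘(ℝ, F) J (extChartAt J p.2).symm y.2) := by
    rw [hsymm, modelWithCornersSelf_prod, ← chartedSpaceSelf_prod]
    exact mfderiv_prodMap (mdifferentiableAt_extChartAt_symm hy₁)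
      (mdifferentiableAt_extChartAt_symm hy₂)
  change g.prod h ((extChartAt (I.prod J) p).symm y) (mfderiv _ _ _ y v) (mfderiv _ _ _ y w) = _
  rw [TwoTensor.prod_apply, hderiv, hsymm]
  rfl

theorem IsRiemannianCovering.exists_chartCoefficients_eq_pullback [J.Boundaryless]
    [IsManifold J ∞ N] {h : TwoTensor I M} {g : TwoTensor J N} {p : M → N}
    (hp : IsRiemannianCovering h g p) (s : N) {y : F} (hy : y ∈ (extChartAt J s).target) :
    ∃ r : F → M, ContMDiffAt 𝓘(ℝ, F) I ∞ r y ∧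
      ∀ᶠ z in 𝓝 y, MDifferentiableAt 𝓘(ℝ, F) I r z ∧
        chartCoefficients g s z = TwoTensor.pullback 𝓘(ℝ, F) h r z := by
  obtain ⟨⟨-, hsurj, hloc⟩, rfl⟩ := hp
  obtain ⟨t, ht⟩ := hsurj ((extChartAt J s).symm y)
  set φ := (extChartAt J s).symm
  set q := (hloc t).localInverse
  have hr {z : F} (hz : z ∈ (extChartAt J s).target) (hqz : φ z ∈ q.source) :
      ContMDiffAt 𝓘(ℝ, F) I ∞ (q ∘ φ) z :=
    ((hloc t).localInverse_contMDiffOn.contMDiffAt (q.open_source.mem_nhds hqz)).comp z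
      (contMDiffAt_extChartAt_symm_of_mem_target hz)
  have hyq : φ y ∈ q.source := ht ▸ (hloc t).localInverse_mem_source
  have hdom : ∀ᶠ z in 𝓝 y, z ∈ (extChartAt J s).target ∧ φ z ∈ q.source :=
    ((isOpen_extChartAt_target s).eventually_mem hy).and
      ((mdifferentiableAt_extChartAt_symm hy).continuousAt.eventually
        (q.open_source.eventually_mem hyq))
  refine ⟨q ∘ φ, hr hy hyq, ?_⟩
  filter_upwards [hdom.eventually_nhds] with z hz
  have hrz : MDifferentiableAt 𝓘(ℝ, F) I (q ∘ φ) z :=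
    (hr hz.self_of_nhds.1 hz.self_of_nhds.2).mdifferentiableAt (by simp)
  have hlift : φ =ᶠ[𝓝 z] p ∘ q ∘ φ :=
    hz.mono fun z' hz' => ((hloc t).localInverse_right_inv hz'.2).symm
  exact ⟨hrz, (TwoTensor.pullback_congr g hlift).trans
    (TwoTensor.pullback_comp g (hloc.contMDiff.contMDiffAt.mdifferentiableAt (by simp)) hrz)⟩

end Charts

/-! ### The round metric, hyperbolic quotients and their products in charts -/

section Models

open scoped Topology InnerProductSpace

section General

variable {E : Type*} [NormedAddCommGroup E] [NormedSpace ℝ E]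
  {F : Type*} [NormedAddCommGroup F] [NormedSpace ℝ F]

theorem isInvertible_fderiv_of_isInnerProduct_pullbackForm [FiniteDimensional ℝ E]
    [FiniteDimensional ℝ F] {h : F → F →L[ℝ] F →L[ℝ] ℝ} {φ : E → F} {y : E}
    (hEF : finrank ℝ E = finrank ℝ F)
    (hφ : IsInnerProduct (pullbackForm h φ y)) : (fderiv ℝ φ y).IsInvertible := by
  have hinj : Function.Injective (fderiv ℝ φ y).toLinearMap := by
    refine (injective_iff_map_eq_zero _).2 fun v hv => ?_
    by_contra hne
    refine (hφ.pos v hne).ne' ?_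
    rw [pullbackForm_apply, show fderiv ℝ φ y v = 0 from hv, map_zero]
  exact ⟨(LinearEquiv.ofInjectiveOfFinrankEq _ hinj hEF).toContinuousLinearEquiv,
    ContinuousLinearMap.ext fun _ => rfl⟩

theorem flatMetric_pullback_apply {d : ℕ} (f : E → EuclideanSpace ℝ (Fin d)) (y v w : E) :
    TwoTensor.pullback 𝓘(ℝ, E) (flatMetric d) f y v w = ⟪fderiv ℝ f y v, fderiv ℝ f y w⟫_ℝ := by
  rw [← mfderiv_eq_fderiv]
  rfl

theorem hyperbolicMetric_pullback_apply {k : ℕ} {r : E → upperHalfSpace k} {y : E}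
    (hr : MDifferentiableAt 𝓘(ℝ, E) (𝓡 (k + 1)) r y) (v w : E) :
    TwoTensor.pullback 𝓘(ℝ, E) (hyperbolicMetric k) r y v w =
      hyperbolicFactor (r y).1 *
        ⟪fderiv ℝ (Subtype.val ∘ r) y v, fderiv ℝ (Subtype.val ∘ r) y w⟫_ℝ := by
  have hval : MDifferentiableAt (𝓡 (k + 1)) (𝓡 (k + 1)) (Subtype.val : upperHalfSpace k → _)
      (r y) := (contMDiff_subtype_val (n := ∞)).contMDiffAt.mdifferentiableAt (by simp)
  rw [← flatMetric_pullback_apply, TwoTensor.pullback_comp (flatMetric (k + 1)) hval hr]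
  rfl

end General

theorem isInnerProduct_roundMetric (d : ℕ) (x : UnitSphere d) :
    IsInnerProduct (roundMetric d x) := by
  have : Fact (finrank ℝ (EuclideanSpace ℝ (Fin (d + 1))) = d + 1) := ⟨finrank_euclideanSpace_fin⟩
  have hflat : IsInnerProduct (innerₗ (EuclideanSpace ℝ (Fin (d + 1)))) :=
    ⟨fun v w => real_inner_comm w v, fun v hv => real_inner_self_pos.2 hv⟩
  exact hflat.compl₁₂ (injective_mvfderiv_subtypeVal_sphere (n := d) x)

theorem exists_extChartAt_symm_sphere_eq_stereoInvFunAux (d : ℕ) (x : UnitSphere d) :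
    ∃ U : EuclideanSpace ℝ (Fin d) →ₗᵢ[ℝ] EuclideanSpace ℝ (Fin (d + 1)),
      (∀ w, ⟪(-x).val, U w⟫_ℝ = 0) ∧
        Subtype.val ∘ (extChartAt (𝓡 d) x).symm = fun z => stereoInvFunAux (-x).val (U z) := by
  have : Fact (finrank ℝ (EuclideanSpace ℝ (Fin (d + 1))) = d + 1) := ⟨finrank_euclideanSpace_fin⟩
  let U := (OrthonormalBasis.fromOrthogonalSpanSingleton (𝕜 := ℝ) d
    (ne_zero_of_mem_unit_sphere (-x))).repr
  refine ⟨(Submodule.subtypeₗᵢ _).comp U.symm.toLinearIsometry, fun w =>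
    Submodule.mem_orthogonal_singleton_iff_inner_right.1 (U.symm w).2, funext fun z => ?_⟩
  rw [stereoInvFunAux_apply, smul_add]
  exact stereographic'_symm_apply (n := d) (-x) z

theorem chartCoefficients_roundMetric (d : ℕ) (x : UnitSphere d)
    (y v w : EuclideanSpace ℝ (Fin d)) :
    chartCoefficients (roundMetric d) x y v w = roundFactor y * ⟪v, w⟫_ℝ := by
  have : Fact (finrank ℝ (EuclideanSpace ℝ (Fin (d + 1))) = d + 1) := ⟨finrank_euclideanSpace_fin⟩
  have hy : y ∈ (extChartAt (𝓡 d) x).target := by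
    rw [extChartAt_target, show (chartAt (EuclideanSpace ℝ (Fin d)) x).target = Set.univ from
      stereographic'_target (-x)]
    simp
  have hmanifold : IsManifold (𝓡 d) ∞ (UnitSphere d) := inferInstance
  have hval : MDifferentiableAt (𝓡 d) (𝓡 (d + 1)) (Subtype.val : UnitSphere d → _)
      ((extChartAt (𝓡 d) x).symm y) :=
    (contMDiff_coe_sphere (m := ∞)).mdifferentiableAt (by simp)
  obtain ⟨U, hU, hsymm⟩ := exists_extChartAt_symm_sphere_eq_stereoInvFunAux d x
  rw [← inner_fderiv_stereoInvFunAux_comp U (norm_eq_of_mem_sphere (-x)) hU, ← hsymm,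
    ← flatMetric_pullback_apply,
    TwoTensor.pullback_comp _ hval (mdifferentiableAt_extChartAt_symm hy)]
  rfl

variable {m k : ℕ} {S : Type*} [TopologicalSpace S]
  [ChartedSpace (EuclideanSpace ℝ (Fin (k + 1))) S] [IsManifold (𝓡 (k + 1)) ∞ S]
  {g : TwoTensor (𝓡 (k + 1)) S} {p : upperHalfSpace k → S}

/-- The local isometry lifts the chart through the covering, into the upper half-space. -/
theorem exists_isLocalIsometryAt_hyperbolic (hp : IsRiemannianCovering (hyperbolicMetric k) g p)
    (hg : ∀ s, IsInnerProduct (g s)) (s : S) {y : EuclideanSpace ℝ (Fin (k + 1))}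
    (hy : y ∈ (extChartAt (𝓡 (k + 1)) s).target) :
    ∃ ψ : EuclideanSpace ℝ (Fin (k + 1)) → EuclideanSpace ℝ (Fin (k + 1)), 0 < ψ y 0 ∧
      IsLocalIsometryAt (chartCoefficients g s)
        (fun x => hyperbolicFactor x • realInner (EuclideanSpace ℝ (Fin (k + 1)))) ψ y := by
  obtain ⟨r, hr, hev⟩ := hp.exists_chartCoefficients_eq_pullback s hy
  have heq : chartCoefficients g s =ᶠ[𝓝 y]
      pullbackForm (fun x => hyperbolicFactor x • realInner (EuclideanSpace ℝ (Fin (k + 1))))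
        (Subtype.val ∘ r) := by
    filter_upwards [hev] with z ⟨hrz, hz⟩
    refine LinearMap.ext₂ fun v w => ?_
    rw [hz]
    exact hyperbolicMetric_pullback_apply hrz v w
  have hsmooth : ContDiffAt ℝ ∞ (Subtype.val ∘ r) y :=
    contMDiffAt_iff_contDiffAt.1 (contMDiff_subtype_val.contMDiffAt.comp y hr)
  exact ⟨Subtype.val ∘ r, (r y).2, hsmooth.of_le ENat.LEInfty.out,
    isInvertible_fderiv_of_isInnerProduct_pullbackForm rfl
      (heq.self_of_nhds ▸ isInnerProduct_chartCoefficients hg s hy), heq⟩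

theorem exists_isLocalIsometryAt_conformalProd
    (hp : IsRiemannianCovering (hyperbolicMetric k) g p) (hg : ∀ s, IsInnerProduct (g s))
    (x : UnitSphere m × S) {y : EuclideanSpace ℝ (Fin m) × EuclideanSpace ℝ (Fin (k + 1))}
    (hy : y ∈ (extChartAt ((𝓡 m).prod (𝓡 (k + 1))) x).target) :
    ∃ φ : EuclideanSpace ℝ (Fin m) × EuclideanSpace ℝ (Fin (k + 1)) →
        EuclideanSpace ℝ (Fin m) × EuclideanSpace ℝ (Fin (k + 1)), 0 < (φ y).2 0 ∧
      IsLocalIsometryAt (chartCoefficients ((roundMetric m).prod g) x)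
        (conformalProd roundFactor hyperbolicFactor) φ y := by
  have hmem {z : EuclideanSpace ℝ (Fin m) × EuclideanSpace ℝ (Fin (k + 1))}
      (hz : z ∈ (extChartAt ((𝓡 m).prod (𝓡 (k + 1))) x).target) :
      z.1 ∈ (extChartAt (𝓡 m) x.1).target ∧ z.2 ∈ (extChartAt (𝓡 (k + 1)) x.2).target := by
    rwa [extChartAt_prod, PartialEquiv.prod_target] at hz
  obtain ⟨ψ, hψpos, hψ⟩ := exists_isLocalIsometryAt_hyperbolic hp hg x.2 (hmem hy).2
  have hfderiv {z : EuclideanSpace ℝ (Fin m) × EuclideanSpace ℝ (Fin (k + 1))}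
      (hz : DifferentiableAt ℝ ψ z.2) :
      fderiv ℝ (Prod.map id ψ) z = (ContinuousLinearMap.id ℝ _).prodMap (fderiv ℝ ψ z.2) :=
    (HasFDerivAt.prodMap (f := id) (p := z) (hasFDerivAt_id _) hz.hasFDerivAt).fderiv
  have hdiff : ∀ᶠ z in 𝓝 y.2, DifferentiableAt ℝ ψ z :=
    (hψ.contDiffAt.eventually (by simp)).mono fun z hz => hz.differentiableAt (by simp)
  refine ⟨Prod.map id ψ, hψpos, ContDiffAt.prodMap' (f := id) (p := y) contDiffAt_id
    hψ.contDiffAt, ?_, ?_⟩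
  · obtain ⟨e, he⟩ := hψ.isInvertible
    rw [hfderiv hdiff.self_of_nhds, ← he]
    exact ⟨(ContinuousLinearEquiv.refl ℝ _).prodCongr e, rfl⟩
  · filter_upwards [(isOpen_extChartAt_target x).eventually_mem hy,
      continuousAt_snd.eventually hψ.eventuallyEq, continuousAt_snd.eventually hdiff]
      with z hz hψz hdz
    refine LinearMap.ext₂ fun v w => ?_
    rw [chartCoefficients_prod _ _ x (hmem hz).1 (hmem hz).2, chartCoefficients_roundMetric, hψz,
      pullbackForm_apply, pullbackForm_apply, hfderiv hdz]
    rfl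

theorem scalarCurvature_roundMetric_prod (hp : IsRiemannianCovering (hyperbolicMetric k) g p)
    (hg : ∀ s, IsInnerProduct (g s)) (x : UnitSphere m × S) :
    scalarCurvature ((roundMetric m).prod g) x = (m - 1) * m - k * (k + 1) := by
  obtain ⟨φ, hpos, hφ⟩ := exists_isLocalIsometryAt_conformalProd hp hg x (mem_extChartAt_target x)
  have hhyp : ∀ᶠ z in 𝓝 (φ (extChartAt ((𝓡 m).prod (𝓡 (k + 1))) x x)).2,
      IsConformalFactorAt hyperbolicFactor hyperbolicGradient z :=
    ((upperHalfSpace k).isOpen.eventually_mem hpos).mono fun _ => isConformalFactorAt_hyperbolic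
  rw [scalarCurvature, localScalarCurvature_of_isLocalIsometryAt_conformalProd hφ
    (.of_forall isConformalFactorAt_round) hhyp (hasCurvatureAt_round _)
    (hasCurvatureAt_hyperbolic hpos), finrank_euclideanSpace_fin, finrank_euclideanSpace_fin]
  push_cast
  ring

theorem continuousOn_chartCoefficients_roundMetric_prod
    (hp : IsRiemannianCovering (hyperbolicMetric k) g p) (hg : ∀ s, IsInnerProduct (g s))
    (x : UnitSphere m × S) (v w : EuclideanSpace ℝ (Fin m) × EuclideanSpace ℝ (Fin (k + 1))) :
    ContinuousOn (fun y => chartCoefficients ((roundMetric m).prod g) x y v w)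
      (extChartAt ((𝓡 m).prod (𝓡 (k + 1))) x).target := by
  intro y hy
  obtain ⟨φ, hpos, hφ⟩ := exists_isLocalIsometryAt_conformalProd hp hg x hy
  have hfderiv (u) : ContinuousAt (fun z => fderiv ℝ φ z u) y :=
    (hφ.contDiffAt.continuousAt_fderiv (by simp)).clm_apply continuousAt_const
  have hround : ContinuousAt (fun z => roundFactor (φ z).1) y :=
    (isConformalFactorAt_round _).hasFDerivAt.continuousAt.comp
      (f := fun z => (φ z).1) hφ.contDiffAt.continuousAt.fst
  have hhyp : ContinuousAt (fun z => hyperbolicFactor (φ z).2) y :=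
    (isConformalFactorAt_hyperbolic hpos).hasFDerivAt.continuousAt.comp
      (f := fun z => (φ z).2) hφ.contDiffAt.continuousAt.snd
  have hcoeff : (fun y => chartCoefficients ((roundMetric m).prod g) x y v w) =ᶠ[𝓝 y] fun z =>
      roundFactor (φ z).1 * ⟪(fderiv ℝ φ z v).1, (fderiv ℝ φ z w).1⟫_ℝ +
        hyperbolicFactor (φ z).2 * ⟪(fderiv ℝ φ z v).2, (fderiv ℝ φ z w).2⟫_ℝ := by
    filter_upwards [hφ.eventuallyEq] with z hz
    rw [hz, pullbackForm_apply, conformalProd_apply]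
  exact (((hround.mul ((hfderiv v).fst.inner (hfderiv w).fst)).add
    (hhyp.mul ((hfderiv v).snd.inner (hfderiv w).snd))).congr hcoeff.symm).continuousWithinAt

end Models

/-! ### The Riemannian volume measure -/

section Volume

open scoped Topology ENNReal

theorem restrict_iSup_le {α ι : Type*} [MeasurableSpace α] {μ : ι → Measure α} {ν : Measure α}
    {s : Set α} (hs : MeasurableSet s) (h : ∀ i, (μ i).restrict s ≤ ν) :
    (⨆ i, μ i).restrict s ≤ ν := by
  have hle : ⨆ i, μ i ≤ ν + (⨆ i, μ i).restrict sᶜ := iSup_le fun i => by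
    rw [← Measure.restrict_add_restrict_compl (μ := μ i) hs]
    exact add_le_add (h i) (Measure.restrict_mono le_rfl (le_iSup μ i))
  calc (⨆ i, μ i).restrict s
      ≤ (ν + (⨆ i, μ i).restrict sᶜ).restrict s := Measure.restrict_mono le_rfl hle
    _ = ν.restrict s := by
        rw [Measure.restrict_add, Measure.restrict_restrict hs, Set.inter_compl_self,
          Measure.restrict_empty, add_zero]
    _ ≤ ν := Measure.restrict_le_self

variable {E : Type*} [NormedAddCommGroup E] [NormedSpace ℝ E]
  {H : Type*} [TopologicalSpace H] {I : ModelWithCorners ℝ E H} [I.Boundaryless]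
  {M : Type*} [TopologicalSpace M] [ChartedSpace H M]

section ChartMeasure

variable [MeasurableSpace E] [BorelSpace E] [MeasurableSpace M] [BorelSpace M]

theorem aemeasurable_extChartAt_symm (x : M) (μ : Measure E) :
    AEMeasurable (extChartAt I x).symm (μ.restrict (extChartAt I x).target) :=
  (continuousOn_extChartAt_symm x).aemeasurable (isOpen_extChartAt_target x).measurableSet

theorem measurableSet_extChartAt_image (x : M) {A : Set M} (hA : MeasurableSet A)
    (hAs : A ⊆ (extChartAt I x).source) : MeasurableSet (extChartAt I x '' A) := by
  have hrestrict : Measurable ((extChartAt I x).target.domRestrict (extChartAt I x).symm) :=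
    (continuousOn_iff_continuous_domRestrict.1 (continuousOn_extChartAt_symm x)).measurable
  have himage : extChartAt I x '' A = Subtype.val ''
      ((extChartAt I x).target.domRestrict (extChartAt I x).symm ⁻¹' A) := by
    rw [(extChartAt I x).image_eq_target_inter_inv_preimage hAs, Set.domRestrict_eq,
      Set.preimage_comp, Subtype.image_preimage_coe]
  rw [himage]
  exact (isOpen_extChartAt_target (I := I) x).measurableSet.subtype_image (hrestrict hA)

variable [FiniteDimensional ℝ E]

/-- The density `√det (g_ij)` of the Riemannian volume in the chart at `x`. -/
def chartDensity (g : TwoTensor I M) (x : M) (y : E) : ℝ :=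
  √(gram (finBasis ℝ E) (chartCoefficients g x y)).det

theorem restrict_chartVolume (g : TwoTensor I M) (x : M) {A : Set M} (hA : MeasurableSet A) :
    (chartVolume g x).restrict A = Measure.map (extChartAt I x).symm
      (((finBasis ℝ E).addHaar.restrict
        ((extChartAt I x).target ∩ (extChartAt I x).symm ⁻¹' A)).withDensity fun y =>
          ENNReal.ofReal (chartDensity g x y)) := by
  rw [chartVolume, Measure.restrict_map_of_aemeasurable
    ((aemeasurable_extChartAt_symm x _).mono_ac (withDensity_absolutelyContinuous _ _)) hA,
    restrict_withDensity', Measure.restrict_restrict' (isOpen_extChartAt_target x).measurableSet,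
    Set.inter_comm]
  rfl

theorem restrict_chartVolume_source (g : TwoTensor I M) (x : M) :
    (chartVolume g x).restrict (extChartAt I x).source = chartVolume g x := by
  rw [restrict_chartVolume g x (isOpen_extChartAt_source x).measurableSet,
    Set.inter_eq_left.2 (extChartAt I x).target_subset_preimage_source]
  rfl

theorem chartVolume_apply (g : TwoTensor I M) (x : M) {A : Set M} (hA : MeasurableSet A)
    (hAs : A ⊆ (extChartAt I x).source) :
    chartVolume g x A = ∫⁻ y in extChartAt I x '' A,
      ENNReal.ofReal (chartDensity g x y) ∂(finBasis ℝ E).addHaar := by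
  rw [chartVolume, Measure.map_apply_of_aemeasurable
    ((aemeasurable_extChartAt_symm x _).mono_ac (withDensity_absolutelyContinuous _ _)) hA,
    withDensity_apply', Measure.restrict_restrict' (isOpen_extChartAt_target x).measurableSet,
    Set.inter_comm, ← (extChartAt I x).image_eq_target_inter_inv_preimage hAs]
  rfl

end ChartMeasure

variable [IsManifold I ∞ M]

theorem contDiffAt_chartTransition {x₀ x₁ : M} {y : E} (hy : y ∈ (extChartAt I x₀).target)
    (hy' : (extChartAt I x₀).symm y ∈ (extChartAt I x₁).source) :
    ContDiffAt ℝ ∞ (extChartAt I x₁ ∘ (extChartAt I x₀).symm) y := by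
  rw [← contMDiffAt_iff_contDiffAt]
  rw [extChartAt_source] at hy'
  exact (contMDiffAt_extChartAt' hy').comp y (contMDiffAt_extChartAt_symm_of_mem_target hy)

theorem chartCoefficients_eq_compl₁₂_chartTransition (g : TwoTensor I M) {x₀ x₁ : M} {y : E}
    (hy : y ∈ (extChartAt I x₀).target)
    (hy' : (extChartAt I x₀).symm y ∈ (extChartAt I x₁).source) :
    chartCoefficients g x₀ y =
      (chartCoefficients g x₁ (extChartAt I x₁ ((extChartAt I x₀).symm y))).compl₁₂
        (fderiv ℝ (extChartAt I x₁ ∘ (extChartAt I x₀).symm) y).toLinearMap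
        (fderiv ℝ (extChartAt I x₁ ∘ (extChartAt I x₀).symm) y).toLinearMap := by
  have hfactor : (extChartAt I x₀).symm =ᶠ[𝓝 y]
      (extChartAt I x₁).symm ∘ (extChartAt I x₁ ∘ (extChartAt I x₀).symm) := by
    filter_upwards [(continuousAt_extChartAt_symm'' hy).eventually
      ((isOpen_extChartAt_source x₁).eventually_mem hy')] with z hz
    exact ((extChartAt I x₁).left_inv hz).symm
  have hpullback := (TwoTensor.pullback_congr g hfactor).trans (TwoTensor.pullback_comp
    (I := 𝓘(ℝ, E)) (J := 𝓘(ℝ, E)) g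
    (mdifferentiableAt_extChartAt_symm ((extChartAt I x₁).map_source hy'))
    ((contDiffAt_chartTransition hy hy').differentiableAt (by simp)).mdifferentiableAt)
  rw [← mfderiv_eq_fderiv]
  exact hpullback

variable [FiniteDimensional ℝ E]

theorem gradNormSq_eq_cometric {g : TwoTensor I M} (hg : ∀ x, IsInnerProduct (g x)) {u : M → ℝ}
    {x : M} {y : E} (hy : y ∈ (extChartAt I x).target)
    (hu : MDifferentiableAt I 𝓘(ℝ, ℝ) u ((extChartAt I x).symm y)) :
    gradNormSq g u ((extChartAt I x).symm y) =
      cometric (finBasis ℝ E) (chartCoefficients g x y)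
        (fderiv ℝ (u ∘ (extChartAt I x).symm) y) := by
  obtain ⟨A, hA⟩ := isInvertible_mfderiv_extChartAt_symm hy
  have hchain : fderiv ℝ (u ∘ (extChartAt I x).symm) y =
      (mfderiv I 𝓘(ℝ, ℝ) u ((extChartAt I x).symm y)).comp A.toContinuousLinearMap := by
    rw [← mfderiv_eq_fderiv, hA]
    exact mfderiv_comp y hu (mdifferentiableAt_extChartAt_symm hy)
  have hcoeff : chartCoefficients g x y =
      (g ((extChartAt I x).symm y)).compl₁₂ A.toLinearMap A.toLinearMap := by
    change (g _).compl₁₂ (mfderiv 𝓘(ℝ, E) I (extChartAt I x).symm y).toLinearMap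
      (mfderiv 𝓘(ℝ, E) I (extChartAt I x).symm y).toLinearMap = _
    rw [← hA]
    rfl
  rw [hchain, hcoeff]
  exact (cometric_compl₁₂ (finBasis ℝ E) (finBasis ℝ E) (hg _) _ A).symm

variable [MeasurableSpace E] [BorelSpace E] [MeasurableSpace M] [BorelSpace M]

theorem chartVolume_eq_of_subset (g : TwoTensor I M) (x₀ x₁ : M) {A : Set M}
    (hA : MeasurableSet A) (h₀ : A ⊆ (extChartAt I x₀).source)
    (h₁ : A ⊆ (extChartAt I x₁).source) : chartVolume g x₀ A = chartVolume g x₁ A := by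
  set τ := extChartAt I x₁ ∘ (extChartAt I x₀).symm with hτ
  have hleft {z : M} (hz : z ∈ A) : (extChartAt I x₀).symm (extChartAt I x₀ z) = z :=
    (extChartAt I x₀).left_inv (h₀ hz)
  have hτ_apply {z : M} (hz : z ∈ A) : τ (extChartAt I x₀ z) = extChartAt I x₁ z := by
    rw [hτ, Function.comp_apply, hleft hz]
  have hdom : ∀ y ∈ extChartAt I x₀ '' A, y ∈ (extChartAt I x₀).target ∧
      (extChartAt I x₀).symm y ∈ (extChartAt I x₁).source := by
    rintro _ ⟨z, hz, rfl⟩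
    exact ⟨(extChartAt I x₀).map_source (h₀ hz), by simpa only [hleft hz] using h₁ hz⟩
  have hτ_injOn : Set.InjOn τ (extChartAt I x₀ '' A) := by
    rintro _ ⟨z, hz, rfl⟩ _ ⟨w, hw, rfl⟩ hzw
    rw [hτ_apply hz, hτ_apply hw] at hzw
    rw [(extChartAt I x₁).injOn (h₁ hz) (h₁ hw) hzw]
  have hτ_image : τ '' (extChartAt I x₀ '' A) = extChartAt I x₁ '' A := by
    rw [Set.image_image]
    exact Set.image_congr fun z hz => hτ_apply hz
  rw [chartVolume_apply g x₀ hA h₀, chartVolume_apply g x₁ hA h₁, ← hτ_image,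
    lintegral_image_eq_lintegral_abs_det_fderiv_mul _ (measurableSet_extChartAt_image x₀ hA h₀)
      (fun y hy => ((contDiffAt_chartTransition (hdom y hy).1
        (hdom y hy).2).differentiableAt (by simp)).hasFDerivAt.hasFDerivWithinAt) hτ_injOn]
  refine setLIntegral_congr_fun (measurableSet_extChartAt_image x₀ hA h₀) fun y hy => ?_
  rw [← ENNReal.ofReal_mul (abs_nonneg _), chartDensity, chartDensity,
    chartCoefficients_eq_compl₁₂_chartTransition g (hdom y hy).1 (hdom y hy).2,
    det_gram_compl₁₂, Real.sqrt_mul (sq_nonneg _), Real.sqrt_sq_eq_abs]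
  rfl

theorem restrict_riemannianVolume_source (g : TwoTensor I M) (x : M) :
    (riemannianVolume g).restrict (extChartAt I x).source = chartVolume g x := by
  have hsource (z : M) : MeasurableSet (extChartAt I z).source :=
    (isOpen_extChartAt_source z).measurableSet
  refine le_antisymm (restrict_iSup_le (hsource x) fun z => Measure.le_iff.2 fun B hB => ?_) ?_
  · have hBx := hB.inter (hsource x)
    calc (chartVolume g z).restrict (extChartAt I x).source B
        = chartVolume g z (B ∩ (extChartAt I x).source ∩ (extChartAt I z).source) := by
          rw [Measure.restrict_apply hB, ← Measure.restrict_apply hBx,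
            restrict_chartVolume_source]
      _ = chartVolume g x (B ∩ (extChartAt I x).source ∩ (extChartAt I z).source) :=
          chartVolume_eq_of_subset g z x (hBx.inter (hsource z)) Set.inter_subset_right
            (Set.inter_subset_left.trans Set.inter_subset_right)
      _ ≤ chartVolume g x B :=
          measure_mono (Set.inter_subset_left.trans Set.inter_subset_left)
  · rw [← restrict_chartVolume_source g x]
    exact Measure.restrict_mono le_rfl (le_iSup (chartVolume g) x)

theorem setLIntegral_riemannianVolume {g : TwoTensor I M} {x : M}
    (hg : ContinuousOn (chartDensity g x) (extChartAt I x).target) {A : Set M}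
    (hA : MeasurableSet A) (hAs : A ⊆ (extChartAt I x).source) {f : M → ℝ≥0∞}
    (hf : Measurable f) :
    ∫⁻ z in A, f z ∂riemannianVolume g = ∫⁻ y in extChartAt I x '' A,
      ENNReal.ofReal (chartDensity g x y) * f ((extChartAt I x).symm y)
        ∂(finBasis ℝ E).addHaar := by
  have hsubset : extChartAt I x '' A ⊆ (extChartAt I x).target :=
    (Set.image_mono hAs).trans (extChartAt I x).image_source_eq_target.subset
  have hsymm : AEMeasurable (extChartAt I x).symm
      ((finBasis ℝ E).addHaar.restrict (extChartAt I x '' A)) :=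
    (aemeasurable_extChartAt_symm x _).mono_measure (Measure.restrict_mono hsubset le_rfl)
  have hdensity : AEMeasurable (fun y => ENNReal.ofReal (chartDensity g x y))
      ((finBasis ℝ E).addHaar.restrict (extChartAt I x '' A)) :=
    ((hg.mono hsubset).aemeasurable (measurableSet_extChartAt_image x hA hAs)).ennreal_ofReal
  have hrestrict : (riemannianVolume g).restrict A = Measure.map (extChartAt I x).symm
      (((finBasis ℝ E).addHaar.restrict (extChartAt I x '' A)).withDensity fun y =>
        ENNReal.ofReal (chartDensity g x y)) := by
    rw [(extChartAt I x).image_eq_target_inter_inv_preimage hAs, ← restrict_chartVolume g x hA,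
      ← restrict_riemannianVolume_source g x, Measure.restrict_restrict hA,
      Set.inter_eq_left.2 hAs]
  rw [hrestrict, lintegral_map' hf.aemeasurable
    (hsymm.mono_ac (withDensity_absolutelyContinuous _ _))]
  exact lintegral_withDensity_eq_lintegral_mul₀ hdensity (hf.comp_aemeasurable hsymm)

end Volume

/-! ### Continuous Riemannian metrics -/

section ContinuousMetric

open scoped Topology ENNReal NNReal

theorem continuousOn_cometric {X : Type*} [TopologicalSpace X] {E : Type*} [NormedAddCommGroup E]
    [NormedSpace ℝ E] {ι : Type*} [Fintype ι] [DecidableEq ι] (b : Basis ι ℝ E)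
    {B : X → LinearMap.BilinForm ℝ E} {l : X → E →L[ℝ] ℝ} {s : Set X}
    (hB : ∀ v w, ContinuousOn (fun x => B x v w) s) (hpos : ∀ x ∈ s, IsInnerProduct (B x))
    (hl : ContinuousOn l s) : ContinuousOn (fun x => cometric b (B x) (l x)) s := by
  have hgram : ContinuousOn (fun x => gram b (B x)) s :=
    continuousOn_pi.2 fun i => continuousOn_pi.2 fun j => hB (b i) (b j)
  have hinv : ContinuousOn (fun x => (gram b (B x))⁻¹) s := fun x hx =>
    (continuousAt_matrix_inv (gram b (B x)) (by
      rw [Ring.inverse_eq_inv']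
      exact continuousAt_inv₀ (det_gram_pos b (hpos x hx)).ne')).comp_continuousWithinAt
      (f := fun x => gram b (B x)) (hgram x hx)
  have hentry (i j : ι) : ContinuousOn (fun x => (gram b (B x))⁻¹ i j) s :=
    continuousOn_pi.1 (continuousOn_pi.1 hinv i) j
  exact continuousOn_finsetSum _ fun i _ => continuousOn_finsetSum _ fun j _ =>
    ((hentry i j).mul (hl.clm_apply continuousOn_const)).mul (hl.clm_apply continuousOn_const)

variable {E : Type*} [NormedAddCommGroup E] [NormedSpace ℝ E]
  {H : Type*} [TopologicalSpace H] {I : ModelWithCorners ℝ E H}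
  {M : Type*} [TopologicalSpace M] [ChartedSpace H M]

theorem isOpen_extChartAt_symm_image (x : M) {T : Set E} (hT : IsOpen T)
    (hTt : T ⊆ (extChartAt I x).target) : IsOpen ((extChartAt I x).symm '' T) := by
  rw [PartialEquiv.symm_image_eq_source_inter_preimage _ hTt]
  exact (continuousOn_extChartAt x).isOpen_inter_preimage (isOpen_extChartAt_source x) hT

theorem extChartAt_symm_image_mem_nhds (x : M) {T : Set E} (hT : IsOpen T)
    (hTt : T ⊆ (extChartAt I x).target) (hx : extChartAt I x x ∈ T) :
    (extChartAt I x).symm '' T ∈ 𝓝 x :=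
  (isOpen_extChartAt_symm_image x hT hTt).mem_nhds
    ⟨_, hx, (extChartAt I x).left_inv (mem_extChartAt_source x)⟩

theorem contDiffAt_comp_extChartAt_symm [I.Boundaryless] [IsManifold I ∞ M]
    {u : M → ℝ} (hu : ContMDiff I 𝓘(ℝ, ℝ) ∞ u) {x : M} {y : E}
    (hy : y ∈ (extChartAt I x).target) : ContDiffAt ℝ ∞ (u ∘ (extChartAt I x).symm) y :=
  contMDiffAt_iff_contDiffAt.1
    (hu.contMDiffAt.comp y (contMDiffAt_extChartAt_symm_of_mem_target hy))

variable [FiniteDimensional ℝ E]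

/-- Riemannian metrics with continuous coefficients in the preferred charts, the regularity
which the Sobolev inequality needs. -/
structure IsContinuousMetric (g : TwoTensor I M) : Prop where
  isInnerProduct : ∀ x, IsInnerProduct (g x)
  continuousOn : ∀ x v w,
    ContinuousOn (fun y => chartCoefficients g x y v w) (extChartAt I x).target

namespace IsContinuousMetric

variable {g : TwoTensor I M}

theorem gradNormSq_nonneg (hg : IsContinuousMetric g) (u : M → ℝ) (x : M) :
    0 ≤ gradNormSq g u x :=
  cometric_nonneg (finBasis ℝ E) (hg.isInnerProduct x) _

theorem continuousOn_chartDensity (hg : IsContinuousMetric g) (x : M) :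
    ContinuousOn (chartDensity g x) (extChartAt I x).target :=
  Real.continuous_sqrt.comp_continuousOn (continuous_id.matrix_det.comp_continuousOn
    (continuousOn_pi.2 fun _ => continuousOn_pi.2 fun _ => hg.continuousOn x _ _))

theorem exists_chartCoefficients_le (hg : IsContinuousMetric g) (x : M) {K : Set E}
    (hK : IsCompact K) (hKt : K ⊆ (extChartAt I x).target) :
    ∃ Λ : ℝ≥0, ∀ y ∈ K, ∀ v, chartCoefficients g x y v v ≤ Λ * ‖v‖ ^ 2 := by
  have hcont : ContinuousOn (fun y => (chartCoefficients g x y).toContinuousBilinearMap) K :=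
    continuousOn_clm_apply.2 fun v => continuousOn_clm_apply.2 fun w =>
      (hg.continuousOn x v w).mono hKt
  obtain ⟨Λ, hΛ⟩ := hK.exists_bound_of_continuousOn (E := E →L[ℝ] E →L[ℝ] ℝ) hcont
  refine ⟨Λ.toNNReal, fun y hy v => ?_⟩
  calc chartCoefficients g x y v v
      ≤ ‖(chartCoefficients g x y).toContinuousBilinearMap‖ * ‖v‖ * ‖v‖ :=
        (Real.le_norm_self _).trans
          ((chartCoefficients g x y).toContinuousBilinearMap.le_opNorm₂ v v)
    _ ≤ Λ.toNNReal * ‖v‖ ^ 2 := by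
        rw [mul_assoc, ← sq]
        gcongr
        exact (hΛ y hy).trans (Real.le_coe_toNNReal Λ)

theorem exists_chartDensity_le (hg : IsContinuousMetric g) (x : M) {K : Set E}
    (hK : IsCompact K) (hKt : K ⊆ (extChartAt I x).target) :
    ∃ D : ℝ≥0, ∀ y ∈ K, ENNReal.ofReal (chartDensity g x y) ≤ D := by
  obtain ⟨D, hD⟩ := hK.exists_bound_of_continuousOn ((hg.continuousOn_chartDensity x).mono hKt)
  exact ⟨D.toNNReal, fun y hy =>
    ENNReal.ofReal_le_ofReal ((Real.le_norm_self _).trans (hD y hy))⟩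

variable [I.Boundaryless] [IsManifold I ∞ M]

theorem chartDensity_pos (hg : IsContinuousMetric g) {x : M} {y : E}
    (hy : y ∈ (extChartAt I x).target) : 0 < chartDensity g x y :=
  Real.sqrt_pos.2 (det_gram_pos _ (isInnerProduct_chartCoefficients hg.isInnerProduct x hy))

theorem exists_le_chartDensity (hg : IsContinuousMetric g) (x : M) {K : Set E}
    (hK : IsCompact K) (hKt : K ⊆ (extChartAt I x).target) :
    ∃ d > 0, ∀ y ∈ K, d ≤ chartDensity g x y :=
  hK.exists_forall_le' ((hg.continuousOn_chartDensity x).mono hKt)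
    fun _ hy => hg.chartDensity_pos (hKt hy)

theorem continuous_gradNormSq (hg : IsContinuousMetric g) {u : M → ℝ}
    (hu : ContMDiff I 𝓘(ℝ, ℝ) ∞ u) : Continuous (gradNormSq g u) := by
  refine continuous_iff_continuousAt.2 fun x => ?_
  have hchart : gradNormSq g u =ᶠ[𝓝 x] (fun y => cometric (finBasis ℝ E)
      (chartCoefficients g x y) (fderiv ℝ (u ∘ (extChartAt I x).symm) y)) ∘ extChartAt I x := by
    filter_upwards [extChartAt_source_mem_nhds (I := I) x] with z hz
    rw [Function.comp_apply, ← gradNormSq_eq_cometric hg.isInnerProduct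
      ((extChartAt I x).map_source hz) (hu.mdifferentiableAt (by simp)),
      (extChartAt I x).left_inv hz]
  have hcont : ContinuousOn (fun y => cometric (finBasis ℝ E) (chartCoefficients g x y)
      (fderiv ℝ (u ∘ (extChartAt I x).symm) y)) (extChartAt I x).target :=
    continuousOn_cometric _ (hg.continuousOn x)
      (fun y hy => isInnerProduct_chartCoefficients hg.isInnerProduct x hy)
      fun y hy => ((contDiffAt_comp_extChartAt_symm hu hy).continuousAt_fderiv
        (by simp)).continuousWithinAt
  exact ((hcont.continuousAt (extChartAt_target_mem_nhds x)).comp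
    (continuousAt_extChartAt x)).congr hchart.symm

variable [MeasurableSpace E] [BorelSpace E] [MeasurableSpace M] [BorelSpace M]

theorem setLIntegral_symm_image (hg : IsContinuousMetric g) (x : M) {T : Set E} (hT : IsOpen T)
    (hTt : T ⊆ (extChartAt I x).target) {f : M → ℝ≥0∞} (hf : Measurable f) :
    ∫⁻ z in (extChartAt I x).symm '' T, f z ∂riemannianVolume g =
      ∫⁻ y in T, ENNReal.ofReal (chartDensity g x y) * f ((extChartAt I x).symm y)
        ∂(finBasis ℝ E).addHaar := by
  rw [setLIntegral_riemannianVolume (hg.continuousOn_chartDensity x)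
    (isOpen_extChartAt_symm_image x hT hTt).measurableSet
    ((Set.image_mono hTt).trans (extChartAt I x).symm_image_target_eq_source.subset) hf,
    (extChartAt I x).image_symm_image_of_subset_target hTt]

theorem isLocallyFiniteMeasure (hg : IsContinuousMetric g) :
    IsLocallyFiniteMeasure (riemannianVolume g) := by
  refine ⟨fun x => ?_⟩
  obtain ⟨r, hr, hrt⟩ := Metric.nhds_basis_closedBall.mem_iff.1
    (extChartAt_target_mem_nhds (I := I) x)
  obtain ⟨D, hD⟩ := hg.exists_chartDensity_le x (isCompact_closedBall _ _) hrt
  have hbt := Metric.ball_subset_closedBall.trans hrt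
  refine ⟨_, extChartAt_symm_image_mem_nhds x Metric.isOpen_ball hbt (Metric.mem_ball_self hr), ?_⟩
  rw [← setLIntegral_one, hg.setLIntegral_symm_image x Metric.isOpen_ball hbt measurable_const]
  calc ∫⁻ y in Metric.ball (extChartAt I x x) r, ENNReal.ofReal (chartDensity g x y) * 1
        ∂(finBasis ℝ E).addHaar
      ≤ ∫⁻ _ in Metric.ball (extChartAt I x x) r, D ∂(finBasis ℝ E).addHaar :=
        setLIntegral_mono measurable_const fun y hy => by
          rw [mul_one]
          exact hD y (Metric.ball_subset_closedBall hy)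
    _ < ⊤ := by
        rw [setLIntegral_const]
        exact ENNReal.mul_lt_top ENNReal.coe_lt_top measure_ball_lt_top

theorem riemannianVolume_ne_zero [Nonempty M] (hg : IsContinuousMetric g) :
    riemannianVolume g ≠ 0 := by
  obtain ⟨x⟩ := ‹Nonempty M›
  obtain ⟨r, hr, hrt⟩ := Metric.nhds_basis_closedBall.mem_iff.1
    (extChartAt_target_mem_nhds (I := I) x)
  obtain ⟨d, hd, hle⟩ := hg.exists_le_chartDensity x (isCompact_closedBall _ _) hrt
  have hpos : 0 < riemannianVolume g
      ((extChartAt I x).symm '' Metric.ball (extChartAt I x x) r) := by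
    rw [← setLIntegral_one, hg.setLIntegral_symm_image x Metric.isOpen_ball
      (Metric.ball_subset_closedBall.trans hrt) measurable_const]
    calc 0 < ENNReal.ofReal d * (finBasis ℝ E).addHaar (Metric.ball (extChartAt I x x) r) :=
          ENNReal.mul_pos (ENNReal.ofReal_pos.2 hd).ne' (Metric.measure_ball_pos _ _ hr).ne'
      _ = ∫⁻ _ in Metric.ball (extChartAt I x x) r, ENNReal.ofReal d ∂(finBasis ℝ E).addHaar :=
          (setLIntegral_const _ _).symm
      _ ≤ _ := setLIntegral_mono' measurableSet_ball fun y hy => by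
          rw [mul_one]
          exact ENNReal.ofReal_le_ofReal (hle y (Metric.ball_subset_closedBall hy))
  intro hzero
  rw [hzero] at hpos
  exact hpos.false

end IsContinuousMetric

end ContinuousMetric

/-! ### The Sobolev inequality and the Yamabe constant -/

section EuclideanSobolev

open scoped ENNReal NNReal

variable {E : Type*} [NormedAddCommGroup E] [NormedSpace ℝ E] [FiniteDimensional ℝ E]

theorem contDiff_bump_mul {c : E} (χ : ContDiffBump c) {n : ℕ∞} {R : ℝ} (hR : χ.rOut < R)
    {w : E → ℝ} (hw : ContDiffOn ℝ n w (Metric.ball c R)) :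
    ContDiff ℝ n fun y => χ y * w y := by
  refine contMDiff_iff_contDiff.1 (contMDiff_of_tsupport fun y hy =>
    (χ.contDiffAt.mul ?_).contMDiffAt)
  have hyR : y ∈ Metric.ball c R := Metric.closedBall_subset_ball hR
    (χ.tsupport_eq ▸ closure_mono (Function.support_mul_subset_left _ _) hy)
  exact hw.contDiffAt (Metric.isOpen_ball.mem_nhds hyR)

theorem support_fderiv_bump_mul_subset {c : E} (χ : ContDiffBump c) {R : ℝ} (hR : χ.rOut < R)
    (w : E → ℝ) : Function.support (fderiv ℝ fun y => χ y * w y) ⊆ Metric.ball c R :=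
  (support_fderiv_subset ℝ).trans <| (closure_mono (Function.support_mul_subset_left _ _)).trans <|
    χ.tsupport_eq.trans_subset (Metric.closedBall_subset_ball hR)

theorem norm_fderiv_bump_mul_sq_le {c : E} (χ : ContDiffBump c) {L : ℝ} {y : E}
    (hL : ‖fderiv ℝ χ y‖ ≤ L) {w : E → ℝ} (hw : DifferentiableAt ℝ w y) :
    ‖fderiv ℝ (fun z => χ z * w z) y‖ ^ 2 ≤ (1 + L ^ 2) * (‖fderiv ℝ w y‖ ^ 2 + w y ^ 2) := by
  have hderiv : fderiv ℝ (fun z => χ z * w z) y = χ y • fderiv ℝ w y + w y • fderiv ℝ χ y :=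
    fderiv_fun_mul ((χ.contDiff (n := 1)).differentiable one_ne_zero y) hw
  have hnorm : ‖fderiv ℝ (fun z => χ z * w z) y‖ ≤ ‖fderiv ℝ w y‖ + |w y| * L := by
    rw [hderiv]
    refine (norm_add_le _ _).trans (add_le_add ?_ ?_)
    · rw [norm_smul, Real.norm_eq_abs, abs_of_nonneg χ.nonneg]
      exact mul_le_of_le_one_left (norm_nonneg _) χ.le_one
    · rw [norm_smul, Real.norm_eq_abs]
      exact mul_le_mul_of_nonneg_left hL (abs_nonneg _)
  calc ‖fderiv ℝ (fun z => χ z * w z) y‖ ^ 2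
      ≤ (‖fderiv ℝ w y‖ + |w y| * L) ^ 2 := pow_le_pow_left₀ (norm_nonneg _) hnorm 2
    _ ≤ (1 + L ^ 2) * (‖fderiv ℝ w y‖ ^ 2 + |w y| ^ 2) := by
        nlinarith [sq_nonneg (‖fderiv ℝ w y‖ * L - |w y|)]
    _ = (1 + L ^ 2) * (‖fderiv ℝ w y‖ ^ 2 + w y ^ 2) := by rw [sq_abs]

variable [MeasurableSpace E] [BorelSpace E]

theorem lintegral_rpow_le_lintegral_fderiv (μ : Measure E) [μ.IsAddHaarMeasure]
    (hn : 2 < finrank ℝ E) {v : E → ℝ} (hv : ContDiff ℝ 1 v) (hc : HasCompactSupport v) :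
    (∫⁻ y, ‖v y‖ₑ ^ (2 * (finrank ℝ E : ℝ) / (finrank ℝ E - 2)) ∂μ) ^
        (((finrank ℝ E : ℝ) - 2) / finrank ℝ E) ≤
      (SNormLESNormFDerivOfEqConst ℝ μ 2 : ℝ≥0∞) ^ 2 * ∫⁻ y, ‖fderiv ℝ v y‖ₑ ^ 2 ∂μ := by
  set n : ℝ := ((finrank ℝ E : ℕ) : ℝ)
  have hn2 : 2 < n := Nat.ofNat_lt_cast.2 hn
  have hp : 0 < 2 * n / (n - 2) := div_pos (by linarith) (by linarith)
  obtain ⟨p, hp_eq⟩ : ∃ p : ℝ≥0, (p : ℝ) = 2 * n / (n - 2) := ⟨⟨_, hp.le⟩, rfl⟩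
  have hp_ne : p ≠ 0 := fun h => hp.ne' (by rw [← hp_eq, h, NNReal.coe_zero])
  have hp_conj : (p : ℝ)⁻¹ = ((2 : ℝ≥0) : ℝ)⁻¹ - n⁻¹ := by
    rw [hp_eq, NNReal.coe_ofNat, inv_div]
    field_simp
  have hexp : 1 / (p : ℝ) * 2 = (n - 2) / n := by
    rw [hp_eq]
    field_simp
  have hsobolev := eLpNorm_le_eLpNorm_fderiv_of_eq (F := ℝ) μ hv hc (p := 2) (p' := p)
    one_le_two (by omega) hp_conj
  rw [eLpNorm_nnreal_eq_lintegral hp_ne, eLpNorm_nnreal_eq_lintegral two_ne_zero] at hsobolev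
  have hsq := ENNReal.rpow_le_rpow hsobolev zero_le_two
  rw [ENNReal.mul_rpow_of_nonneg _ _ zero_le_two, ← ENNReal.rpow_mul, ← ENNReal.rpow_mul, hexp,
    hp_eq, NNReal.coe_ofNat, one_div_mul_cancel two_ne_zero, ENNReal.rpow_one,
    ENNReal.rpow_two] at hsq
  simpa only [ENNReal.rpow_two] using hsq

theorem exists_setLIntegral_rpow_le_setLIntegral_fderiv (μ : Measure E) [μ.IsAddHaarMeasure]
    (hn : 2 < finrank ℝ E) (c : E) {r R : ℝ} (hr : 0 < r) (hrR : r < R) :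
    ∃ C : ℝ≥0, ∀ w : E → ℝ, ContDiffOn ℝ 1 w (Metric.ball c R) →
      (∫⁻ y in Metric.ball c r, ‖w y‖ₑ ^ (2 * (finrank ℝ E : ℝ) / (finrank ℝ E - 2)) ∂μ) ^
        (((finrank ℝ E : ℝ) - 2) / finrank ℝ E) ≤
      C * ∫⁻ y in Metric.ball c R, ENNReal.ofReal (‖fderiv ℝ w y‖ ^ 2 + w y ^ 2) ∂μ := by
  let χ : ContDiffBump c := ⟨r, (r + R) / 2, hr, by linarith⟩
  have hχ : χ.rOut < R := by
    change (r + R) / 2 < R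
    linarith
  obtain ⟨L, hL⟩ := (χ.hasCompactSupport.fderiv (𝕜 := ℝ)).exists_bound_of_continuous
    ((χ.contDiff (n := 1)).continuous_fderiv one_ne_zero)
  refine ⟨SNormLESNormFDerivOfEqConst ℝ μ 2 ^ 2 * (1 + L ^ 2).toNNReal, fun w hw => ?_⟩
  set v : E → ℝ := fun y => χ y * w y
  have hleft : ∫⁻ y in Metric.ball c r, ‖w y‖ₑ ^ (2 * (finrank ℝ E : ℝ) / (finrank ℝ E - 2)) ∂μ ≤
      ∫⁻ y, ‖v y‖ₑ ^ (2 * (finrank ℝ E : ℝ) / (finrank ℝ E - 2)) ∂μ := by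
    refine le_trans (setLIntegral_mono' measurableSet_ball fun y hy => ?_)
      (setLIntegral_le_lintegral (Metric.ball c r) _)
    simp only [v, χ.one_of_mem_closedBall (Metric.ball_subset_closedBall hy), one_mul, le_refl]
  have hsupport : Function.support (fun y => ‖fderiv ℝ v y‖ₑ ^ 2) ⊆ Metric.ball c R := by
    refine fun y hy => support_fderiv_bump_mul_subset χ hχ w fun hzero => hy ?_
    have hnorm : ‖fderiv ℝ v y‖ = 0 := (congrArg norm hzero).trans norm_zero
    simp only [← ofReal_norm, hnorm, ENNReal.ofReal_zero, zero_pow two_ne_zero]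
  have hright : ∫⁻ y, ‖fderiv ℝ v y‖ₑ ^ 2 ∂μ ≤ (1 + L ^ 2).toNNReal *
      ∫⁻ y in Metric.ball c R, ENNReal.ofReal (‖fderiv ℝ w y‖ ^ 2 + w y ^ 2) ∂μ := by
    rw [← setLIntegral_eq_of_support_subset hsupport,
      ← lintegral_const_mul' _ _ ENNReal.coe_ne_top]
    refine setLIntegral_mono' measurableSet_ball fun y hy => ?_
    rw [← ofReal_norm, ← ENNReal.ofReal_pow (norm_nonneg _), ← ENNReal.ofReal,
      ← ENNReal.ofReal_mul (by positivity)]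
    exact ENNReal.ofReal_le_ofReal (norm_fderiv_bump_mul_sq_le χ (hL y)
      ((hw.differentiableOn one_ne_zero).differentiableAt (Metric.isOpen_ball.mem_nhds hy)))
  have hexp : 0 ≤ ((finrank ℝ E : ℝ) - 2) / finrank ℝ E :=
    div_nonneg (sub_nonneg.2 (by exact_mod_cast hn.le)) (Nat.cast_nonneg _)
  refine (ENNReal.rpow_le_rpow hleft hexp).trans ((lintegral_rpow_le_lintegral_fderiv μ hn
    (contDiff_bump_mul χ (n := 1) hχ hw) χ.hasCompactSupport.mul_right).trans ?_)
  rw [ENNReal.coe_mul, ENNReal.coe_pow, mul_assoc]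
  gcongr

end EuclideanSobolev

section Yamabe

open scoped Topology ENNReal NNReal

variable {E : Type*} [NormedAddCommGroup E] [NormedSpace ℝ E] [FiniteDimensional ℝ E]
  {H : Type*} [TopologicalSpace H] {I : ModelWithCorners ℝ E H} [I.Boundaryless]
  {M : Type*} [TopologicalSpace M] [ChartedSpace H M] [IsManifold I ∞ M]
  {g : TwoTensor I M}

namespace IsContinuousMetric

theorem exists_norm_fderiv_sq_le (hg : IsContinuousMetric g) (x : M) {K : Set E}
    (hK : IsCompact K) (hKt : K ⊆ (extChartAt I x).target) :
    ∃ Λ : ℝ≥0, ∀ u : M → ℝ, ContMDiff I 𝓘(ℝ, ℝ) ∞ u → ∀ y ∈ K,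
      ‖fderiv ℝ (u ∘ (extChartAt I x).symm) y‖ ^ 2 ≤
        Λ * gradNormSq g u ((extChartAt I x).symm y) := by
  obtain ⟨Λ, hΛ⟩ := hg.exists_chartCoefficients_le x hK hKt
  refine ⟨Λ, fun u hu y hy => ?_⟩
  rw [gradNormSq_eq_cometric hg.isInnerProduct (hKt hy) (hu.mdifferentiableAt (by simp))]
  exact norm_sq_le_mul_cometric _ (isInnerProduct_chartCoefficients hg.isInnerProduct x (hKt hy))
    Λ.coe_nonneg (hΛ y hy) _

variable [MeasurableSpace E] [BorelSpace E] [MeasurableSpace M] [BorelSpace M]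

theorem exists_setLIntegral_symm_image_le (hg : IsContinuousMetric g) (x : M) {T K : Set E}
    (hT : IsOpen T) (hTK : T ⊆ K) (hK : IsCompact K) (hKt : K ⊆ (extChartAt I x).target) :
    ∃ D : ℝ≥0, ∀ f : M → ℝ≥0∞, Measurable f →
      ∫⁻ z in (extChartAt I x).symm '' T, f z ∂riemannianVolume g ≤
        D * ∫⁻ y in T, f ((extChartAt I x).symm y) ∂(finBasis ℝ E).addHaar := by
  obtain ⟨D, hD⟩ := hg.exists_chartDensity_le x hK hKt
  refine ⟨D, fun f hf => ?_⟩
  rw [hg.setLIntegral_symm_image x hT (hTK.trans hKt) hf,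
    ← lintegral_const_mul' _ _ ENNReal.coe_ne_top]
  refine setLIntegral_mono' hT.measurableSet fun y hy => ?_
  gcongr
  exact hD y (hTK hy)

theorem exists_setLIntegral_le_symm_image (hg : IsContinuousMetric g) (x : M) {T K : Set E}
    (hT : IsOpen T) (hTK : T ⊆ K) (hK : IsCompact K) (hKt : K ⊆ (extChartAt I x).target) :
    ∃ D : ℝ≥0, ∀ f : M → ℝ≥0∞, Measurable f →
      ∫⁻ y in T, f ((extChartAt I x).symm y) ∂(finBasis ℝ E).addHaar ≤
        D * ∫⁻ z in (extChartAt I x).symm '' T, f z ∂riemannianVolume g := by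
  obtain ⟨d, hd, hle⟩ := hg.exists_le_chartDensity x hK hKt
  refine ⟨d⁻¹.toNNReal, fun f hf => ?_⟩
  rw [hg.setLIntegral_symm_image x hT (hTK.trans hKt) hf,
    ← lintegral_const_mul' _ _ ENNReal.coe_ne_top]
  refine setLIntegral_mono' hT.measurableSet fun y hy => ?_
  rw [← ENNReal.ofReal, ← mul_assoc, ← ENNReal.ofReal_mul (inv_nonneg.2 hd.le)]
  refine le_mul_of_one_le_left zero_le (ENNReal.one_le_ofReal.2 ?_)
  rw [← div_eq_inv_mul, one_le_div hd]
  exact hle y (hTK hy)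

theorem exists_setLIntegral_norm_fderiv_sq_le (hg : IsContinuousMetric g) (x : M) {T K : Set E}
    (hT : IsOpen T) (hTK : T ⊆ K) (hK : IsCompact K) (hKt : K ⊆ (extChartAt I x).target) :
    ∃ C : ℝ≥0, ∀ u : M → ℝ, ContMDiff I 𝓘(ℝ, ℝ) ∞ u →
      ∫⁻ y in T, ENNReal.ofReal (‖fderiv ℝ (u ∘ (extChartAt I x).symm) y‖ ^ 2 +
          (u ∘ (extChartAt I x).symm) y ^ 2) ∂(finBasis ℝ E).addHaar ≤
        C * ∫⁻ z, ENNReal.ofReal (gradNormSq g u z + u z ^ 2) ∂riemannianVolume g := by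
  obtain ⟨D, hD⟩ := hg.exists_setLIntegral_le_symm_image x hT hTK hK hKt
  obtain ⟨Λ, hΛ⟩ := hg.exists_norm_fderiv_sq_le x hK hKt
  refine ⟨(Λ + 1) * D, fun u hu => ?_⟩
  have henergy : Continuous fun z => gradNormSq g u z + u z ^ 2 :=
    (hg.continuous_gradNormSq hu).add (hu.continuous.pow 2)
  rw [ENNReal.coe_mul, mul_assoc]
  refine le_trans ?_ (mul_le_mul_right ((hD _ henergy.measurable.ennreal_ofReal).trans
    (mul_le_mul_right (setLIntegral_le_lintegral _ _) _)) _)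
  rw [← lintegral_const_mul' _ _ ENNReal.coe_ne_top]
  refine setLIntegral_mono' hT.measurableSet fun y hy => ?_
  rw [← ENNReal.ofReal_coe_nnreal, ← ENNReal.ofReal_mul (Λ + 1).coe_nonneg, NNReal.coe_add,
    NNReal.coe_one]
  refine ENNReal.ofReal_le_ofReal ((add_le_add_left (hΛ u hu y (hTK hy)) _).trans ?_)
  rw [Function.comp_apply]
  nlinarith [hg.gradNormSq_nonneg u ((extChartAt I x).symm y),
    mul_nonneg Λ.coe_nonneg (sq_nonneg (u ((extChartAt I x).symm y)))]

theorem exists_local_sobolev (hg : IsContinuousMetric g) (hn : 2 < finrank ℝ E) (x : M) :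
    ∃ U ∈ 𝓝 x, ∃ C : ℝ≥0, ∀ u : M → ℝ, ContMDiff I 𝓘(ℝ, ℝ) ∞ u →
      (∫⁻ z in U, ‖u z‖ₑ ^ (2 * (finrank ℝ E : ℝ) / (finrank ℝ E - 2)) ∂riemannianVolume g) ^
        (((finrank ℝ E : ℝ) - 2) / finrank ℝ E) ≤
      C * ∫⁻ z, ENNReal.ofReal (gradNormSq g u z + u z ^ 2) ∂riemannianVolume g := by
  obtain ⟨R, hR, hRt⟩ := Metric.nhds_basis_closedBall.mem_iff.1
    (extChartAt_target_mem_nhds (I := I) x)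
  set c := extChartAt I x x
  set θ : ℝ := ((finrank ℝ E : ℝ) - 2) / finrank ℝ E
  have hθ : 0 ≤ θ :=
    div_nonneg (sub_nonneg.2 (by exact_mod_cast hn.le)) (Nat.cast_nonneg _)
  have hR' : Metric.ball c R ⊆ Metric.closedBall c R := Metric.ball_subset_closedBall
  have hr' : Metric.ball c (R / 2) ⊆ Metric.closedBall c R :=
    (Metric.ball_subset_ball (half_le_self hR.le)).trans hR'
  have hK := isCompact_closedBall c R
  obtain ⟨D, hD⟩ := hg.exists_setLIntegral_symm_image_le x Metric.isOpen_ball hr' hK hRt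
  obtain ⟨B, hB⟩ := hg.exists_setLIntegral_norm_fderiv_sq_le x Metric.isOpen_ball hR' hK hRt
  obtain ⟨C, hC⟩ := exists_setLIntegral_rpow_le_setLIntegral_fderiv (finBasis ℝ E).addHaar hn c
    (half_pos hR) (half_lt_self hR)
  refine ⟨_, extChartAt_symm_image_mem_nhds x Metric.isOpen_ball (hr'.trans hRt)
    (Metric.mem_ball_self (half_pos hR)), D ^ θ * (C * B), fun u hu => ?_⟩
  set w : E → ℝ := u ∘ (extChartAt I x).symm
  calc (∫⁻ z in (extChartAt I x).symm '' Metric.ball c (R / 2),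
        ‖u z‖ₑ ^ (2 * (finrank ℝ E : ℝ) / (finrank ℝ E - 2)) ∂riemannianVolume g) ^ θ
      ≤ (D * ∫⁻ y in Metric.ball c (R / 2), ‖w y‖ₑ ^ (2 * (finrank ℝ E : ℝ) / (finrank ℝ E - 2))
          ∂(finBasis ℝ E).addHaar) ^ θ :=
        ENNReal.rpow_le_rpow (hD _ (hu.continuous.measurable.enorm.pow_const _)) hθ
    _ ≤ (D : ℝ≥0∞) ^ θ * (C * (B *
          ∫⁻ z, ENNReal.ofReal (gradNormSq g u z + u z ^ 2) ∂riemannianVolume g)) := by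
        rw [ENNReal.mul_rpow_of_nonneg _ _ hθ]
        gcongr
        exact (hC w fun y hy => ((contDiffAt_comp_extChartAt_symm hu
          (hRt (hR' hy))).of_le (by simp)).contDiffWithinAt).trans (mul_le_mul_right (hB u hu) _)
    _ = _ := by
        simp only [ENNReal.coe_mul, ENNReal.coe_rpow_of_nonneg _ hθ, mul_assoc]

theorem exists_sobolev [CompactSpace M] (hg : IsContinuousMetric g) (hn : 2 < finrank ℝ E) :
    ∃ C : ℝ≥0, ∀ u : M → ℝ, ContMDiff I 𝓘(ℝ, ℝ) ∞ u →
      (∫⁻ z, ‖u z‖ₑ ^ (2 * (finrank ℝ E : ℝ) / (finrank ℝ E - 2)) ∂riemannianVolume g) ^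
        (((finrank ℝ E : ℝ) - 2) / finrank ℝ E) ≤
      C * ∫⁻ z, ENNReal.ofReal (gradNormSq g u z + u z ^ 2) ∂riemannianVolume g := by
  choose U hU C hC using hg.exists_local_sobolev hn
  obtain ⟨t, -, ht⟩ := isCompact_univ.elim_nhds_subcover U fun x _ => hU x
  refine ⟨∑ x ∈ t, C x, fun u hu => ?_⟩
  set n : ℝ := ((finrank ℝ E : ℕ) : ℝ)
  have hn2 : 2 < n := Nat.ofNat_lt_cast.2 hn
  have hθ : 0 < (n - 2) / n := div_pos (by linarith) (by linarith)
  have hθ1 : (n - 2) / n ≤ 1 := (div_le_one (by linarith)).2 (by linarith)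
  set f : M → ℝ≥0∞ := fun z => ‖u z‖ₑ ^ (2 * n / (n - 2))
  have hcover : ∫⁻ z, f z ∂riemannianVolume g ≤
      ∑ x ∈ t, ∫⁻ z in U x, f z ∂riemannianVolume g := by
    rw [← setLIntegral_univ, ← Finset.tsum_subtype t fun x => ∫⁻ z in U x, f z ∂riemannianVolume g]
    refine (lintegral_mono_set ht).trans ?_
    rw [← Finset.set_biUnion_coe, Set.biUnion_eq_iUnion]
    exact lintegral_iUnion_le _ f
  calc (∫⁻ z, f z ∂riemannianVolume g) ^ ((n - 2) / n)
      ≤ (∑ x ∈ t, ∫⁻ z in U x, f z ∂riemannianVolume g) ^ ((n - 2) / n) :=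
        ENNReal.rpow_le_rpow hcover hθ.le
    _ ≤ ∑ x ∈ t, (∫⁻ z in U x, f z ∂riemannianVolume g) ^ ((n - 2) / n) :=
        Finset.le_sum_of_subadditive (fun a : ℝ≥0∞ => a ^ ((n - 2) / n))
          (ENNReal.zero_rpow_of_pos hθ).le
          (fun a b => ENNReal.rpow_add_le_add_rpow a b hθ.le hθ1) _ _
    _ ≤ ∑ x ∈ t, C x * ∫⁻ z, ENNReal.ofReal (gradNormSq g u z + u z ^ 2) ∂riemannianVolume g :=
        Finset.sum_le_sum fun x _ => hC x u hu
    _ = _ := by rw [← Finset.sum_mul, ENNReal.ofNNReal_finsetSum]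

theorem integrable_of_continuous [CompactSpace M] (hg : IsContinuousMetric g) {f : M → ℝ}
    (hf : Continuous f) : Integrable f (riemannianVolume g) :=
  have := hg.isLocallyFiniteMeasure
  hf.integrable_of_hasCompactSupport (HasCompactSupport.of_compactSpace f)

theorem integral_rpow_pos [CompactSpace M] [Nonempty M] (hg : IsContinuousMetric g)
    {u : M → ℝ} (hu : Continuous u) (hpos : ∀ x, 0 < u x) (p : ℝ) :
    0 < ∫ z, u z ^ p ∂riemannianVolume g := by
  have hpow : ∀ z, 0 < u z ^ p := fun z => Real.rpow_pos_of_pos (hpos z) p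
  rw [integral_pos_iff_support_of_nonneg (fun z => (hpow z).le)
    (hg.integrable_of_continuous (hu.rpow_const fun z => Or.inl (hpos z).ne')),
    Set.eq_univ_of_forall (s := Function.support _) fun z => (hpow z).ne']
  exact Measure.measure_univ_pos.2 hg.riemannianVolume_ne_zero

theorem exists_sobolev_integral [CompactSpace M] [Nonempty M] (hg : IsContinuousMetric g)
    (hn : 2 < finrank ℝ E) :
    ∃ C : ℝ≥0, ∀ u : M → ℝ, ContMDiff I 𝓘(ℝ, ℝ) ∞ u → (∀ x, 0 < u x) →
      (∫ z, u z ^ (2 * (finrank ℝ E : ℝ) / (finrank ℝ E - 2)) ∂riemannianVolume g) ^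
        (((finrank ℝ E : ℝ) - 2) / finrank ℝ E) ≤
      C * ∫ z, (gradNormSq g u z + u z ^ 2) ∂riemannianVolume g := by
  obtain ⟨C, hC⟩ := hg.exists_sobolev hn
  refine ⟨C, fun u hu hpos => ?_⟩
  have hsobolev := hC u hu
  set p : ℝ := 2 * (finrank ℝ E : ℝ) / (finrank ℝ E - 2)
  have henergy : ∀ z, 0 ≤ gradNormSq g u z + u z ^ 2 := fun z =>
    add_nonneg (hg.gradNormSq_nonneg u z) (sq_nonneg _)
  have hcont : Continuous fun z => gradNormSq g u z + u z ^ 2 :=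
    (hg.continuous_gradNormSq hu).add (hu.continuous.pow 2)
  have hpow : ∫⁻ z, ‖u z‖ₑ ^ p ∂riemannianVolume g =
      ENNReal.ofReal (∫ z, u z ^ p ∂riemannianVolume g) := by
    rw [ofReal_integral_eq_lintegral_ofReal (hg.integrable_of_continuous
      (hu.continuous.rpow_const fun z => Or.inl (hpos z).ne'))
      (.of_forall fun z => Real.rpow_nonneg (hpos z).le _)]
    refine lintegral_congr fun z => ?_
    rw [Real.enorm_of_nonneg (hpos z).le, ENNReal.ofReal_rpow_of_pos (hpos z)]
  rw [hpow, ← ofReal_integral_eq_lintegral_ofReal (hg.integrable_of_continuous hcont)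
      (.of_forall henergy),
    ENNReal.ofReal_rpow_of_pos (hg.integral_rpow_pos hu.continuous hpos p),
    ← ENNReal.ofReal_coe_nnreal, ← ENNReal.ofReal_mul C.coe_nonneg] at hsobolev
  exact (ENNReal.ofReal_le_ofReal_iff
    (mul_nonneg C.coe_nonneg (integral_nonneg henergy))).1 hsobolev

theorem min_mul_integral_le [CompactSpace M] (hg : IsContinuousMetric g) (a b : ℝ) {u : M → ℝ}
    (hu : ContMDiff I 𝓘(ℝ, ℝ) ∞ u) :
    min a b * ∫ z, (gradNormSq g u z + u z ^ 2) ∂riemannianVolume g ≤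
      ∫ z, (a * gradNormSq g u z + b * u z ^ 2) ∂riemannianVolume g := by
  have hgrad := hg.continuous_gradNormSq hu
  have hsq : Continuous fun z => u z ^ 2 := hu.continuous.pow 2
  rw [← integral_const_mul]
  refine integral_mono (hg.integrable_of_continuous (continuous_const.mul (hgrad.add hsq)))
    (hg.integrable_of_continuous ((continuous_const.mul hgrad).add (continuous_const.mul hsq)))
    fun z => ?_
  change min a b * (gradNormSq g u z + u z ^ 2) ≤ a * gradNormSq g u z + b * u z ^ 2
  rw [mul_add]
  gcongr
  · exact hg.gradNormSq_nonneg u z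
  · exact min_le_left a b
  · exact min_le_right a b

theorem yamabeConstant_pos [CompactSpace M] [Nonempty M] (hg : IsContinuousMetric g)
    (hn : 2 < finrank ℝ E) {R : ℝ} (hR : 0 < R) (hscal : ∀ x, scalarCurvature g x = R) :
    0 < yamabeConstant g := by
  obtain ⟨C, hC⟩ := hg.exists_sobolev_integral hn
  set n : ℝ := ((finrank ℝ E : ℕ) : ℝ) with hn_def
  have hn2 : 2 < n := Nat.ofNat_lt_cast.2 hn
  have ha : 0 < 4 * (n - 1) / (n - 2) := div_pos (by linarith) (by linarith)
  set c : ℝ := min (4 * (n - 1) / (n - 2)) R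
  have hc : 0 < c := lt_min ha hR
  have : Nonempty {u : M → ℝ // ContMDiff I 𝓘(ℝ, ℝ) ∞ u ∧ ∀ x, 0 < u x} :=
    ⟨⟨fun _ => 1, contMDiff_const, fun _ => one_pos⟩⟩
  refine (div_pos hc (C.coe_nonneg.trans_lt (lt_add_one _))).trans_le
    (le_ciInf fun ⟨u, hu, hpos⟩ => ?_)
  have henergy : 0 ≤ ∫ z, (gradNormSq g u z + u z ^ 2) ∂riemannianVolume g :=
    integral_nonneg fun z => add_nonneg (hg.gradNormSq_nonneg u z) (sq_nonneg _)
  simp only [yamabeQuotient, hscal, ← hn_def]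
  rw [div_le_div_iff₀ (by positivity)
    (Real.rpow_pos_of_pos (hg.integral_rpow_pos hu.continuous hpos _) _)]
  calc c * (∫ z, u z ^ (2 * n / (n - 2)) ∂riemannianVolume g) ^ ((n - 2) / n)
      ≤ c * ((C + 1) * ∫ z, (gradNormSq g u z + u z ^ 2) ∂riemannianVolume g) := by
        gcongr
        exact (hC u hu hpos).trans (by gcongr; exact le_add_of_nonneg_right zero_le_one)
    _ = (c * ∫ z, (gradNormSq g u z + u z ^ 2) ∂riemannianVolume g) * (C + 1) := by ring
    _ ≤ _ := by
        gcongr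
        exact hg.min_mul_integral_le _ R hu

end IsContinuousMetric

end Yamabe

/-! ### Simple connectedness of the sphere -/

section RadialProjection

open scoped unitInterval
open Metric

theorem exists_contDiff_approx_path {E : Type*} [NormedAddCommGroup E] [NormedSpace ℝ E]
    {x y : E} (γ : Path x y) {ε : ℝ} (hε : 0 < ε) :
    ∃ q : ℝ → E, ContDiff ℝ 1 q ∧ q 0 = x ∧ q 1 = y ∧ ∀ t : I, ‖q t - γ t‖ < ε := by
  obtain ⟨G, hG, hGγ, -⟩ := γ.continuous_extend.exists_contDiff_approx 1 (ε := fun _ => ε / 3)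
    continuous_const (fun _ => by positivity)
  have hclose (t : I) : ‖G t - γ t‖ < ε / 3 := by
    simpa only [dist_eq_norm, Path.extend_apply γ t.2] using hGγ t
  have hzero : ‖G 0 - x‖ < ε / 3 := by
    simpa only [γ.source, Set.Icc.coe_zero] using hclose 0
  have hone : ‖G 1 - y‖ < ε / 3 := by
    simpa only [γ.target, Set.Icc.coe_one] using hclose 1
  refine ⟨fun t => G t - (1 - t) • (G 0 - x) - t • (G 1 - y), by fun_prop, by simp, by simp,
    fun t => ?_⟩
  have hzero' : ‖(1 - (t : ℝ)) • (G 0 - x)‖ ≤ ε / 3 := by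
    rw [norm_smul, Real.norm_of_nonneg (sub_nonneg.2 t.2.2)]
    exact (mul_le_of_le_one_left (norm_nonneg _) (sub_le_self _ t.2.1)).trans hzero.le
  have hone' : ‖(t : ℝ) • (G 1 - y)‖ ≤ ε / 3 := by
    rw [norm_smul, Real.norm_of_nonneg t.2.1]
    exact (mul_le_of_le_one_left (norm_nonneg _) t.2.2).trans hone.le
  calc ‖G t - (1 - (t : ℝ)) • (G 0 - x) - (t : ℝ) • (G 1 - y) - γ t‖
      = ‖(G t - γ t) - (1 - (t : ℝ)) • (G 0 - x) - (t : ℝ) • (G 1 - y)‖ := by congr 1; abel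
    _ ≤ ‖G t - γ t‖ + ‖(1 - (t : ℝ)) • (G 0 - x)‖ + ‖(t : ℝ) • (G 1 - y)‖ :=
        (norm_sub_le _ _).trans (add_le_add_left (norm_sub_le _ _) _)
    _ < ε := by linarith [hclose t]

variable {E : Type*} [NormedAddCommGroup E] [NormedSpace ℝ E]

/-- Radial projection of a nonzero vector to the unit sphere. -/
def sphereProj (x : E) (hx : x ≠ 0) : sphere (0 : E) 1 :=
  ⟨‖x‖⁻¹ • x, by simp [norm_smul, hx]⟩

theorem sphereProj_coe (x : sphere (0 : E) 1) (hx : (x : E) ≠ 0) : sphereProj (x : E) hx = x :=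
  Subtype.ext (by simp [sphereProj])

theorem continuous_sphereProj {X : Type*} [TopologicalSpace X] {f : X → E} (hf : Continuous f)
    (hne : ∀ x, f x ≠ 0) : Continuous fun x => sphereProj (f x) (hne x) :=
  ((hf.norm.inv₀ fun x => norm_ne_zero_iff.2 (hne x)).smul hf).subtype_mk _

theorem add_smul_sub_ne_zero {a b : E} (ha : ‖a‖ = 1) (hab : ‖b - a‖ < 1) (s : I) :
    a + (s : ℝ) • (b - a) ≠ 0 := by
  intro h
  have hnorm : ‖(s : ℝ) • (b - a)‖ = 1 := by
    rw [← ha, ← norm_neg a, eq_neg_of_add_eq_zero_right h]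
  rw [norm_smul, Real.norm_of_nonneg s.2.1] at hnorm
  nlinarith [s.2.2, norm_nonneg (b - a)]

theorem exists_homotopic_sphereProj {x : sphere (0 : E) 1} (γ : Path x x) {f : I → E}
    (hf : Continuous f) (hzero : f 0 = x) (hone : f 1 = x) (hfγ : ∀ t, ‖f t - γ t‖ < 1) :
    ∃ δ : Path x x, γ.Homotopic δ ∧ ∀ t, ∃ r : ℝ, (δ t : E) = r • f t := by
  have hne (s t : I) := add_smul_sub_ne_zero (norm_eq_of_mem_sphere (γ t)) (hfγ t) s
  have hfne : ∀ t, f t ≠ 0 := fun t => by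
    simpa only [Set.Icc.coe_one, one_smul, add_sub_cancel] using hne 1 t
  let δ : Path x x :=
    { toFun := fun t => sphereProj (f t) (hfne t)
      continuous_toFun := continuous_sphereProj hf hfne
      source' := by simp only [hzero, sphereProj_coe]
      target' := by simp only [hone, sphereProj_coe] }
  refine ⟨δ, ⟨⟨⟨⟨fun p => sphereProj _ (hne p.1 p.2), continuous_sphereProj ?_ _⟩, ?_, ?_⟩, ?_⟩⟩,
    fun t => ⟨‖f t‖⁻¹, rfl⟩⟩
  · fun_prop
  · intro t
    simp [sphereProj_coe]
  · intro t
    simp [δ]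
  · rintro s t (rfl | rfl)
    · simp [hzero, sphereProj_coe]
    · simp [hone, sphereProj_coe]

theorem exists_ne_zero_forall_smul_ne [FiniteDimensional ℝ E] (hE : 2 < finrank ℝ E)
    {q : ℝ → E} (hq : ContDiff ℝ 1 q) : ∃ v : E, v ≠ 0 ∧ ∀ r t : ℝ, r • q t ≠ v := by
  have hcone : ContDiff ℝ 1 fun p : ℝ × ℝ => p.1 • q p.2 := by fun_prop
  obtain ⟨v, hv⟩ := (hcone.dense_compl_range_of_finrank_lt_finrank (by simpa using hE)).nonempty
  refine ⟨v, ?_, fun r t h => hv ⟨(r, t), h⟩⟩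
  rintro rfl
  exact hv ⟨(0, 0), zero_smul ℝ _⟩

end RadialProjection

section SimplyConnected

open scoped unitInterval
open Metric

variable {E : Type*} [NormedAddCommGroup E] [InnerProductSpace ℝ E]

theorem contractibleSpace_sphere_compl_singleton (v : sphere (0 : E) 1) :
    ContractibleSpace ({v}ᶜ : Set (sphere (0 : E) 1)) := by
  let e := stereographic (norm_eq_of_mem_sphere v)
  have hsource : e.source = {v}ᶜ := stereographic_source _
  have htarget : e.target = Set.univ := stereographic_target _
  have huniv : ContractibleSpace (Set.univ : Set (ℝ ∙ (v : E))ᗮ) :=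
    (Homeomorph.Set.univ _).contractibleSpace
  rw [← htarget] at huniv
  rw [← hsource]
  exact e.toHomeomorphSourceTarget.contractibleSpace

/- A loop is homotopic to the normalization of a nearby `C¹` loop; the cone over the latter has
dimension two, so the normalized loop misses a point, and the complement of a point is
contractible. -/
theorem simplyConnectedSpace_sphere [FiniteDimensional ℝ E] (hE : 2 < finrank ℝ E) :
    SimplyConnectedSpace (sphere (0 : E) 1) := by
  have hrank : 1 < Module.rank ℝ E := by
    rw [← finrank_eq_rank]
    exact_mod_cast one_lt_two.trans hE
  rw [simply_connected_iff_loops_nullhomotopic]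
  refine ⟨isPathConnected_iff_pathConnectedSpace.1 (isPathConnected_sphere hrank 0 zero_le_one),
    fun x γ => ?_⟩
  obtain ⟨q, hq, hzero, hone, hqγ⟩ :=
    exists_contDiff_approx_path (γ.map continuous_subtype_val) one_pos
  obtain ⟨δ, hγδ, hδq⟩ := exists_homotopic_sphereProj γ (f := fun t => q t)
    (hq.continuous.comp continuous_subtype_val) hzero hone hqγ
  obtain ⟨v, hv0, hv⟩ := exists_ne_zero_forall_smul_ne hE hq
  have hδv : ∀ t, δ t ∈ ({sphereProj v hv0}ᶜ : Set (sphere (0 : E) 1)) := by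
    intro t ht
    obtain ⟨r, hr⟩ := hδq t
    rw [Set.mem_singleton_iff.1 ht] at hr
    refine hv (‖v‖ * r) t ?_
    rw [mul_smul, ← hr]
    exact smul_inv_smul₀ (norm_ne_zero_iff.2 hv0) v
  have := contractibleSpace_sphere_compl_singleton (sphereProj v hv0)
  have hs : IsSimplyConnected ({sphereProj v hv0}ᶜ : Set (sphere (0 : E) 1)) :=
    SimplyConnectedSpace.ofContractible _
  obtain ⟨F, -⟩ := (isSimplyConnected_iff_exists_homotopy_refl_forall_mem.1 hs).2 x δ hδv
  exact hγδ.trans ⟨F⟩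

end SimplyConnected

/-! ### Nonexistence of retractions onto the sphere -/

section Determinant

variable {E : Type*} [NormedAddCommGroup E] [NormedSpace ℝ E] [FiniteDimensional ℝ E]

theorem exists_polynomial_eval_eq_det_one_add_smul (A : E →L[ℝ] E) :
    ∃ Q : Polynomial ℝ, Q.natDegree ≤ finrank ℝ E ∧ ∀ t : ℝ, Q.eval t = (1 + t • A).det := by
  set b := finBasis ℝ E
  set B := LinearMap.toMatrix b b A.toLinearMap
  refine ⟨((Polynomial.X : Polynomial ℝ) • B.map Polynomial.C +
    (1 : Matrix _ _ ℝ).map Polynomial.C).det, ?_, fun t => ?_⟩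
  · simpa only [Fintype.card_fin] using Polynomial.natDegree_det_X_add_C_le B 1
  · have hmatrix : LinearMap.toMatrix b b (1 + t • A.toLinearMap) = 1 + t • B := by
      rw [map_add, map_smul, LinearMap.toMatrix_one]
    change _ = LinearMap.det (1 + t • A.toLinearMap)
    rw [← LinearMap.det_toMatrix b, hmatrix, ← Polynomial.coe_evalRingHom, RingHom.map_det]
    congr 1
    ext i j
    rcases eq_or_ne i j with rfl | hij
    · simp [add_comm, mul_comm t]
    · simp [Matrix.one_apply_ne hij, mul_comm t]

theorem det_one_add_eq_sum_lagrange {s : Finset ℕ} {τ : ℕ → ℝ} (hτ : Set.InjOn τ s)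
    (hs : finrank ℝ E < s.card) (A : E →L[ℝ] E) :
    (1 + A).det = ∑ i ∈ s, (1 + τ i • A).det * (Lagrange.basis s τ i).eval 1 := by
  obtain ⟨Q, hdeg, hQ⟩ := exists_polynomial_eval_eq_det_one_add_smul A
  have hinterpolate := Lagrange.eq_interpolate hτ
    (Polynomial.degree_le_natDegree.trans_lt (Nat.cast_lt.2 (hdeg.trans_lt hs)))
  calc (1 + A).det = Q.eval 1 := by rw [hQ, one_smul]
    _ = ∑ i ∈ s, (1 + τ i • A).det * (Lagrange.basis s τ i).eval 1 := by
        rw [hinterpolate, Lagrange.interpolate_apply, Polynomial.eval_finsetSum]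
        simp only [Polynomial.eval_mul, Polynomial.eval_C, hQ]

theorem det_one_add_ne_zero {A : E →L[ℝ] E} (hA : ‖A‖ < 1) : (1 + A).det ≠ 0 := by
  intro hdet
  obtain ⟨v, hv, hv0⟩ := (Submodule.ne_bot_iff _).1
    (LinearMap.bot_lt_ker_of_det_eq_zero (f := (1 + A).toLinearMap) hdet).ne'
  have hAv : ‖A v‖ = ‖v‖ := by
    rw [← norm_neg v]
    exact congrArg norm (eq_neg_of_add_eq_zero_right hv)
  exact ((A.le_opNorm v).trans_lt (mul_lt_of_lt_one_left (norm_pos_iff.2 hv0) hA)).ne hAv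

theorem det_one_add_pos {A : E →L[ℝ] E} (hA : ‖A‖ < 1) : 0 < (1 + A).det := by
  have hcont : Continuous fun s : ℝ => (1 + s • A).det :=
    ContinuousLinearMap.continuous_det.comp
      (continuous_const.add (continuous_id.smul continuous_const))
  have hne : ∀ s ∈ Set.Icc (0 : ℝ) 1, (1 + s • A).det ≠ 0 := fun s hs =>
    det_one_add_ne_zero (by
      rw [norm_smul, Real.norm_of_nonneg hs.1]
      exact (mul_le_of_le_one_left (norm_nonneg A) hs.2).trans_lt hA)
  by_contra! hle
  obtain ⟨s, hs, hs0⟩ := intermediate_value_Icc' zero_le_one hcont.continuousOn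
    (show (0 : ℝ) ∈ _ by
      rw [one_smul, zero_smul, add_zero]
      exact ⟨hle, (zero_le_one' ℝ).trans_eq LinearMap.det_id.symm⟩)
  exact hne s hs hs0

end Determinant

section LipschitzPerturbation

open Metric
open scoped NNReal

variable {E : Type*} [NormedAddCommGroup E] [NormedSpace ℝ E]

theorem exists_norm_eq_one_dist_le {x y : E} (hx : ‖x‖ ≤ 1) (hy : 1 ≤ ‖y‖) :
    ∃ z, ‖z‖ = 1 ∧ dist x z ≤ dist x y := by
  have hcont : ContinuousOn (fun s : ℝ => ‖x + s • (y - x)‖) (Set.Icc 0 1) := by fun_prop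
  obtain ⟨s, hs, hs1⟩ := intermediate_value_Icc zero_le_one hcont
    (show (1 : ℝ) ∈ _ by simpa using ⟨hx, hy⟩)
  refine ⟨_, hs1, ?_⟩
  rw [dist_self_add_right, norm_smul, Real.norm_of_nonneg hs.1, dist_comm, dist_eq_norm]
  exact mul_le_of_le_one_left (norm_nonneg _) hs.2

theorem lipschitzWith_indicator_ball {h : E → E} {K : ℝ≥0}
    (hK : LipschitzOnWith K h (closedBall 0 1)) (hzero : ∀ x, ‖x‖ = 1 → h x = 0) :
    LipschitzWith K ((ball 0 1).indicator h) := by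
  have hin : ∀ x, ‖x‖ ≤ 1 → (ball (0 : E) 1).indicator h x = h x := by
    refine fun x hx => Set.indicator_apply_eq_self.2 fun hxb => hzero x (hx.antisymm ?_)
    rwa [mem_ball_zero_iff, not_lt] at hxb
  have hout : ∀ x, 1 ≤ ‖x‖ → (ball (0 : E) 1).indicator h x = 0 := fun x hx =>
    Set.indicator_of_notMem (by rwa [mem_ball_zero_iff, not_lt]) h
  have hcross : ∀ x y, ‖x‖ ≤ 1 → 1 ≤ ‖y‖ → dist ((ball (0 : E) 1).indicator h x)
      ((ball (0 : E) 1).indicator h y) ≤ K * dist x y := by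
    intro x y hx hy
    obtain ⟨z, hz, hxz⟩ := exists_norm_eq_one_dist_le hx hy
    rw [hin x hx, hout y hy, ← hzero z hz]
    exact (hK.dist_le_mul x (mem_closedBall_zero_iff.2 hx) z
      (mem_closedBall_zero_iff.2 hz.le)).trans (by gcongr)
  refine LipschitzWith.of_dist_le_mul fun x y => ?_
  rcases le_total ‖x‖ 1 with hx | hx <;> rcases le_total ‖y‖ 1 with hy | hy
  · rw [hin x hx, hin y hy]
    exact hK.dist_le_mul x (mem_closedBall_zero_iff.2 hx) y (mem_closedBall_zero_iff.2 hy)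
  · exact hcross x y hx hy
  · rw [dist_comm, dist_comm x]
    exact hcross y x hy hx
  · rw [hout x hx, hout y hy, dist_self]
    positivity

theorem bijective_id_add_of_lipschitzWith [CompleteSpace E] {h : E → E} {K : ℝ≥0}
    (hK : LipschitzWith K h) (hK1 : K < 1) : Function.Bijective fun x => x + h x := by
  have happrox : ApproximatesLinearOn (fun x => x + h x)
      ((ContinuousLinearEquiv.refl ℝ E : E ≃L[ℝ] E) : E →L[ℝ] E) Set.univ K := by
    intro x _ y _
    calc ‖x + h x - (y + h y) - (x - y)‖ = ‖h x - h y‖ := by congr 1; abel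
      _ ≤ K * ‖x - y‖ := hK.norm_sub_le x y
  have hsmall : Subsingleton E ∨
      K < ‖((ContinuousLinearEquiv.refl ℝ E).symm : E →L[ℝ] E)‖₊⁻¹ := by
    rcases subsingleton_or_nontrivial E with hE | hE
    · exact .inl hE
    · have hnorm : ‖((ContinuousLinearEquiv.refl ℝ E).symm : E →L[ℝ] E)‖₊ = 1 :=
        NNReal.eq ContinuousLinearMap.norm_id
      exact .inr (by rwa [hnorm, inv_one])
  exact ⟨Set.injOn_univ.1 (happrox.injOn hsmall), happrox.surjective hsmall⟩

theorem image_eq_self_of_forall_notMem_eq {α : Type*} {f : α → α} (hf : Function.Bijective f)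
    {s : Set α} (hid : ∀ x ∉ s, f x = x) : f '' s = s := by
  refine compl_injective ?_
  rw [← Set.image_compl_eq hf]
  exact (Set.image_congr hid).trans (Set.image_id' _)

theorem continuous_det_one_add_smul_fderiv {h : E → E} (hh : ContDiff ℝ 1 h) (t : ℝ) :
    Continuous fun x => (1 + t • fderiv ℝ h x).det :=
  ContinuousLinearMap.continuous_det.comp
    (continuous_const.add ((hh.continuous_fderiv one_ne_zero).const_smul t))

variable [FiniteDimensional ℝ E] [MeasurableSpace E] [BorelSpace E]

/- If `h` is a contraction then `x ↦ x + h x` maps the ball bijectively to itself, so this is the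
change of variables formula. -/
theorem setIntegral_det_one_add_smul_fderiv_of_lt_one (μ : Measure E) [μ.IsAddHaarMeasure]
    {h : E → E} (hh : ContDiff ℝ 1 h) (hzero : ∀ x, ‖x‖ = 1 → h x = 0) {K t : ℝ≥0}
    (hK : LipschitzOnWith K h (closedBall 0 1)) (htK : t * K < 1) :
    ∫ x in ball (0 : E) 1, (1 + (t : ℝ) • fderiv ℝ h x).det ∂μ = μ.real (ball 0 1) := by
  set f : E → E := fun x => x + (ball (0 : E) 1).indicator (fun x => (t : ℝ) • h x) x
  have hlip : LipschitzOnWith (t * K) (fun x => (t : ℝ) • h x) (closedBall 0 1) := by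
    refine LipschitzOnWith.of_dist_le_mul fun x hx y hy => ?_
    rw [dist_smul₀, Real.norm_of_nonneg t.coe_nonneg, NNReal.coe_mul, mul_assoc]
    exact mul_le_mul_of_nonneg_left (hK.dist_le_mul x hx y hy) t.coe_nonneg
  have hbij : Function.Bijective f := bijective_id_add_of_lipschitzWith
    (lipschitzWith_indicator_ball hlip fun x hx => by rw [hzero x hx, smul_zero]) htK
  have himage : f '' ball 0 1 = ball 0 1 := image_eq_self_of_forall_notMem_eq hbij fun x hx => by
    simp only [f, Set.indicator_of_notMem hx, add_zero]
  have hderiv : ∀ x ∈ ball (0 : E) 1,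
      HasFDerivWithinAt f (1 + (t : ℝ) • fderiv ℝ h x) (ball 0 1) x := by
    intro x hx
    have hsum : HasFDerivAt (fun x => x + (t : ℝ) • h x) (1 + (t : ℝ) • fderiv ℝ h x) x :=
      (hasFDerivAt_id x).add ((hh.differentiable one_ne_zero x).hasFDerivAt.const_smul (t : ℝ))
    refine hsum.hasFDerivWithinAt.congr (fun y hy => ?_) ?_
    · simp only [f, Set.indicator_of_mem hy]
    · simp only [f, Set.indicator_of_mem hx]
  have hpos : ∀ x ∈ ball (0 : E) 1, 0 < (1 + (t : ℝ) • fderiv ℝ h x).det := by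
    refine fun x hx => det_one_add_pos ?_
    rw [norm_smul, Real.norm_of_nonneg t.coe_nonneg]
    exact (mul_le_mul_of_nonneg_left (norm_fderiv_le_of_lipschitzOn ℝ
      (Filter.mem_of_superset (isOpen_ball.mem_nhds hx) ball_subset_closedBall) hK)
      t.coe_nonneg).trans_lt (by exact_mod_cast htK)
  rw [integral_eq_lintegral_of_nonneg_ae
    ((ae_restrict_mem measurableSet_ball).mono fun x hx => (hpos x hx).le)
    (continuous_det_one_add_smul_fderiv hh t).aestronglyMeasurable, Measure.real]
  nth_rw 2 [← himage]
  rw [← lintegral_abs_det_fderiv_eq_addHaar_image μ measurableSet_ball hderiv hbij.1.injOn]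
  congr 1
  exact setLIntegral_congr_fun measurableSet_ball fun x hx => by rw [abs_of_pos (hpos x hx)]

/- The integral of `det (1 + t • fderiv ℝ h x)` is a polynomial in `t` which is constant near zero;
interpolating it at small nodes gives its value at `t = 1`. -/
theorem setIntegral_det_one_add_fderiv (μ : Measure E) [μ.IsAddHaarMeasure] {h : E → E}
    (hh : ContDiff ℝ 1 h) (hzero : ∀ x, ‖x‖ = 1 → h x = 0) :
    ∫ x in ball (0 : E) 1, (1 + fderiv ℝ h x).det ∂μ = μ.real (ball 0 1) := by
  obtain ⟨K, hK⟩ := hh.contDiffOn.exists_lipschitzOnWith one_ne_zero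
    (convex_closedBall (0 : E) 1) (isCompact_closedBall 0 1)
  let τ : ℕ → ℝ≥0 := fun i => ((K + 1) * (i + 1))⁻¹
  have hτ_inj : Function.Injective fun i => (τ i : ℝ) := by
    intro i j hij
    have hij' : (K + 1) * ((i : ℝ≥0) + 1) = (K + 1) * (j + 1) := inv_injective (NNReal.eq hij)
    exact_mod_cast add_right_cancel (mul_left_cancel₀ (by positivity) hij')
  have hτK (i : ℕ) : τ i * K < 1 := by
    rw [inv_mul_lt_one₀ (by positivity)]
    calc K < K + 1 := lt_add_one K
      _ ≤ (K + 1) * (i + 1) := le_mul_of_one_le_right' (by simp)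
  set s := Finset.range (finrank ℝ E + 1) with hs
  have hintegrable (i : ℕ) :
      IntegrableOn (fun x => (1 + (τ i : ℝ) • fderiv ℝ h x).det) (ball 0 1) μ :=
    ((continuous_det_one_add_smul_fderiv hh _).continuousOn.integrableOn_compact
      (isCompact_closedBall 0 1)).mono_set ball_subset_closedBall
  calc ∫ x in ball (0 : E) 1, (1 + fderiv ℝ h x).det ∂μ
      = ∫ x in ball (0 : E) 1, ∑ i ∈ s, (1 + (τ i : ℝ) • fderiv ℝ h x).det *
          (Lagrange.basis s (fun i => (τ i : ℝ)) i).eval 1 ∂μ :=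
        integral_congr_ae (.of_forall fun x =>
          det_one_add_eq_sum_lagrange hτ_inj.injOn (by simp [hs]) _)
    _ = ∑ i ∈ s, μ.real (ball 0 1) * (Lagrange.basis s (fun i => (τ i : ℝ)) i).eval 1 := by
        rw [integral_finsetSum _ fun i _ => (hintegrable i).mul_const _]
        exact Finset.sum_congr rfl fun i _ => by
          rw [integral_mul_const,
            setIntegral_det_one_add_smul_fderiv_of_lt_one μ hh hzero hK (hτK i)]
    _ = μ.real (ball 0 1) := by
        rw [← Finset.mul_sum, ← Polynomial.eval_finsetSum,
          Lagrange.sum_basis hτ_inj.injOn (by simp [hs]), Polynomial.eval_one, mul_one]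

end LipschitzPerturbation

section Retraction

open Metric
open scoped Topology unitInterval

variable {E : Type*} [NormedAddCommGroup E] [InnerProductSpace ℝ E]

theorem contDiffAt_norm_inv_smul {x : E} (hx : x ≠ 0) :
    ContDiffAt ℝ 1 (fun z : E => ‖z‖⁻¹ • z) x :=
  ((contDiffAt_norm ℝ hx).inv (norm_ne_zero_iff.2 hx)).smul contDiffAt_id

variable [FiniteDimensional ℝ E]

theorem det_fderiv_eq_zero_of_norm_eq_one {r : E → E} (hr : Differentiable ℝ r)
    (hnorm : ∀ x, ‖r x‖ = 1) (x : E) : (fderiv ℝ r x).det = 0 := by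
  by_contra hdet
  obtain ⟨v, hv⟩ : ∃ v, fderiv ℝ r x v = r x :=
    (LinearMap.equivOfDetNeZero (fderiv ℝ r x).toLinearMap hdet).surjective (r x)
  have hconst : (fun y => inner ℝ (r y) (r y)) = fun _ => (1 : ℝ) := by
    ext y
    rw [real_inner_self_eq_norm_sq, hnorm, one_pow]
  have hderiv := (hr x).hasFDerivAt.inner ℝ (hr x).hasFDerivAt
  rw [hconst] at hderiv
  simpa [hv, hnorm] using DFunLike.congr_fun (hderiv.unique (hasFDerivAt_const (1 : ℝ) x)) v

theorem not_forall_norm_eq_one_of_eqOn_sphere {r : E → E} (hr : ContDiff ℝ 1 r)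
    (hid : ∀ x, ‖x‖ = 1 → r x = x) : ¬ ∀ x, ‖r x‖ = 1 := by
  intro hnorm
  borelize E
  have hdet (x : E) : (1 + fderiv ℝ (fun x => r x - x) x).det = 0 := by
    rw [fderiv_fun_sub (hr.differentiable one_ne_zero x) differentiableAt_fun_id, fderiv_fun_id]
    exact (congrArg ContinuousLinearMap.det (add_sub_cancel _ _)).trans
      (det_fderiv_eq_zero_of_norm_eq_one (hr.differentiable one_ne_zero) hnorm x)
  have hint := setIntegral_det_one_add_fderiv (Measure.addHaar : Measure E)
    (h := fun x => r x - x) (hr.sub contDiff_id) fun x hx => by rw [hid x hx, sub_self]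
  simp only [hdet, integral_zero] at hint
  exact (ENNReal.toReal_pos (measure_ball_pos _ (0 : E) one_pos).ne'
    measure_ball_lt_top.ne).ne hint

/- Approximate `F` by a `C¹` map which agrees with it near the sphere, then normalize. -/
theorem not_forall_norm_eq_one_of_eqOn_annulus {F : E → E} (hF : Continuous F) {a : ℝ}
    (ha0 : 0 ≤ a) (ha : a < 1) (hradial : ∀ x, a < ‖x‖ → F x = ‖x‖⁻¹ • x) :
    ¬ ∀ x, ‖F x‖ = 1 := by
  intro hnorm
  have hnhds : {x : E | a < ‖x‖} ∈ 𝓝ˢ (sphere (0 : E) 1) :=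
    (isOpen_lt continuous_const continuous_norm).mem_nhdsSet.2 fun x hx =>
      ha.trans_eq (mem_sphere_zero_iff_norm.1 hx).symm
  have hsmooth : ContDiffOn ℝ 1 F {x : E | a < ‖x‖} := fun x hx =>
    (contDiffAt_norm_inv_smul (norm_pos_iff.1 (ha0.trans_lt hx))).contDiffWithinAt.congr
      hradial (hradial x hx)
  obtain ⟨G, hG, hGF, hGS, -⟩ := hF.exists_contDiff_approx_and_eqOn 1 (ε := fun _ => 1)
    continuous_const (fun _ => one_pos) isClosed_sphere hnhds hsmooth
  have hGne (x : E) : G x ≠ 0 := by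
    intro hzero
    have hdist := hGF x
    rw [hzero, dist_zero_left, hnorm] at hdist
    exact hdist.false
  refine not_forall_norm_eq_one_of_eqOn_sphere (r := fun x => ‖G x‖⁻¹ • G x)
    (contDiff_iff_contDiffAt.2 fun x =>
      (contDiffAt_norm_inv_smul (hGne x)).comp x hG.contDiffAt) (fun x hx => ?_)
    fun x => norm_smul_inv_norm (𝕜 := ℝ) (hGne x)
  rw [hGS (mem_sphere_zero_iff_norm.2 hx), hradial x (hx ▸ ha), hx, inv_one, one_smul, hx, inv_one,
    one_smul]

/- A contraction of the sphere, run along the radius between `‖x‖ = 1 / 2` and `‖x‖ = 3 / 4`,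
would retract the ball onto the sphere. -/
theorem not_contractibleSpace_sphere : ¬ ContractibleSpace (sphere (0 : E) 1) := by
  intro hcontr
  obtain ⟨y, ⟨H⟩⟩ := id_nullhomotopic (sphere (0 : E) 1)
  classical
  let u : E → sphere (0 : E) 1 := fun x => if hx : x = 0 then y else sphereProj x hx
  let ρ : E → I := fun x => Set.projIcc 0 1 zero_le_one (3 - 4 * ‖x‖)
  let F : E → E := fun x => H (ρ x, u x)
  have hinner (x : E) (hx : ‖x‖ < 1 / 2) : F x = y := by
    have hρ : ρ x = 1 := Set.projIcc_of_right_le _ (by linarith)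
    simp [F, hρ]
  have houter (x : E) (hx : 3 / 4 < ‖x‖) : F x = ‖x‖⁻¹ • x := by
    have hρ : ρ x = 0 := Set.projIcc_of_le_left _ (by linarith)
    have hx0 : x ≠ 0 := norm_pos_iff.1 (by linarith)
    simp [F, hρ, u, hx0, sphereProj]
  have hcont : Continuous F := by
    refine continuous_iff_continuousAt.2 fun x => ?_
    rcases eq_or_ne x 0 with rfl | hx
    · refine (continuousAt_const (y := (y : E))).congr ?_
      filter_upwards [ball_mem_nhds (0 : E) one_half_pos] with z hz
      exact (hinner z (mem_ball_zero_iff.1 hz)).symm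
    · have hu : ContinuousAt u x := by
        rw [Topology.IsInducing.subtypeVal.continuousAt_iff]
        refine (contDiffAt_norm_inv_smul hx).continuousAt.congr ?_
        filter_upwards [isOpen_ne.mem_nhds hx] with z hz
        simp only [Function.comp_apply, u, dif_neg hz, sphereProj]
      have hρ : Continuous ρ := continuous_projIcc.comp (by fun_prop)
      exact continuous_subtype_val.continuousAt.comp
        (H.continuous.continuousAt.comp (hρ.continuousAt.prodMk hu))
  exact not_forall_norm_eq_one_of_eqOn_annulus hcont (by norm_num) (by norm_num) houter
    fun x => norm_eq_of_mem_sphere _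

end Retraction

/-! ### Coverings -/

section Coverings

open scoped Topology

variable {X Y Z : Type*} [TopologicalSpace X] [TopologicalSpace Y] [TopologicalSpace Z]

theorem isEvenlyCovered_prodMap_id {p : Y → Z} {z : Z} {F : Type*} [TopologicalSpace F]
    (h : IsEvenlyCovered p z F) (x : X) :
    IsEvenlyCovered (Prod.map (id : X → X) p) (x, z) F := by
  obtain ⟨hF, U, hzU, hU, hpU, e, he⟩ := h
  have he_symm : ∀ (w : U) (i : F), p (e.symm (w, i)) = w := fun w i => by
    rw [← he, e.apply_symm_apply]
  refine ⟨hF, Set.univ ×ˢ U, ⟨trivial, hzU⟩, isOpen_univ.prod hU, ?_, ?_⟩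
  · rw [Set.preimage_prod_map_prod]
    exact isOpen_univ.prod hpU
  · exact ⟨
      { toFun := fun w => (⟨(w.1.1, (e ⟨w.1.2, w.2.2⟩).1), trivial, (e ⟨w.1.2, w.2.2⟩).1.2⟩,
          (e ⟨w.1.2, w.2.2⟩).2)
        invFun := fun w => ⟨(w.1.1.1, e.symm (⟨w.1.1.2, w.1.2.2⟩, w.2)), trivial, by
          rw [Prod.map_snd, he_symm]; exact w.1.2.2⟩
        left_inv := fun w => by simp
        right_inv := fun w => by simp
        continuous_toFun := by fun_prop
        continuous_invFun := by fun_prop },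
      fun w => Prod.ext rfl (he _)⟩

theorem isCoveringMap_prodMap_id {p : Y → Z} (hp : IsCoveringMap p) :
    IsCoveringMap (Prod.map (id : X → X) p) := fun w =>
  (isEvenlyCovered_prodMap_id (hp w.2) w.1).to_isEvenlyCovered_preimage

theorem homotopyEquiv_prod_of_contractibleSpace [ContractibleSpace Y] :
    Nonempty (ContinuousMap.HomotopyEquiv (X × Y) X) :=
  (ContractibleSpace.hequiv_unit Y).map fun e =>
    ((ContinuousMap.HomotopyEquiv.refl X).prodCongr e).trans
      (Homeomorph.prodPUnit X).toHomotopyEquiv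

theorem simplyConnectedSpace_prod [SimplyConnectedSpace X] [ContractibleSpace Y] :
    SimplyConnectedSpace (X × Y) :=
  (homotopyEquiv_prod_of_contractibleSpace (X := X) (Y := Y)).some.simplyConnectedSpace

theorem contractibleSpace_of_prod_left [ContractibleSpace (X × Y)] [ContractibleSpace Y] :
    ContractibleSpace X :=
  (homotopyEquiv_prod_of_contractibleSpace (X := X) (Y := Y)).some.symm.contractibleSpace

variable {E₁ : Type*} [NormedAddCommGroup E₁] [NormedSpace ℝ E₁]
  {H₁ : Type*} [TopologicalSpace H₁] {I₁ : ModelWithCorners ℝ E₁ H₁} [ChartedSpace H₁ X]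
  {E₂ : Type*} [NormedAddCommGroup E₂] [NormedSpace ℝ E₂]
  {H₂ : Type*} [TopologicalSpace H₂] {I₂ : ModelWithCorners ℝ E₂ H₂} [ChartedSpace H₂ Y]
  {E₃ : Type*} [NormedAddCommGroup E₃] [NormedSpace ℝ E₃]
  {H₃ : Type*} [TopologicalSpace H₃] {I₃ : ModelWithCorners ℝ E₃ H₃} [ChartedSpace H₃ Z]

theorem isLocalDiffeomorph_prodMap_id {p : Y → Z} (hp : IsLocalDiffeomorph I₂ I₃ ∞ p) :
    IsLocalDiffeomorph (I₁.prod I₂) (I₁.prod I₃) ∞ (Prod.map (id : X → X) p) := by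
  intro w
  obtain ⟨Φ, hw, hΦ⟩ := hp w.2
  exact ⟨{ toPartialEquiv := (PartialEquiv.refl X).prod Φ.toPartialEquiv
           open_source := isOpen_univ.prod Φ.open_source
           open_target := isOpen_univ.prod Φ.open_target
           contMDiffOn_toFun := contMDiffOn_id.prodMap Φ.contMDiffOn_toFun
           contMDiffOn_invFun := contMDiffOn_id.prodMap Φ.contMDiffOn_invFun },
    ⟨trivial, hw⟩, fun z hz => Prod.ext rfl (hΦ hz.2)⟩

theorem IsSmoothCovering.prodMap_id {p : Y → Z} (hp : IsSmoothCovering I₂ I₃ p) :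
    IsSmoothCovering (I₁.prod I₂) (I₁.prod I₃) (Prod.map (id : X → X) p) :=
  ⟨isCoveringMap_prodMap_id hp.1, Function.surjective_id.prodMap hp.2.1,
    isLocalDiffeomorph_prodMap_id hp.2.2⟩

theorem IsRiemannianCovering.prodMap_id (g₁ : TwoTensor I₁ X) {g₂ : TwoTensor I₂ Y}
    {g₃ : TwoTensor I₃ Z} {p : Y → Z} (hp : IsRiemannianCovering g₂ g₃ p) :
    IsRiemannianCovering (g₁.prod g₂) (g₁.prod g₃) (Prod.map id p) := by
  refine ⟨hp.1.prodMap_id, funext fun w => LinearMap.ext₂ fun u v => ?_⟩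
  have hmdiff : MDifferentiableAt I₂ I₃ p w.2 :=
    hp.1.2.2.mdifferentiable (by simp) w.2
  rw [TwoTensor.pullback_apply, mfderiv_prodMap mdifferentiableAt_id hmdiff, TwoTensor.prod_apply,
    TwoTensor.prod_apply, ← hp.2, mfderiv_id]
  rfl

theorem contMDiff_of_comp_isLocalDiffeomorph {p : Y → Z} (hp : IsLocalDiffeomorph I₂ I₃ ∞ p)
    {f : X → Y} (hf : Continuous f) (hpf : ContMDiff I₁ I₃ ∞ (p ∘ f)) : ContMDiff I₁ I₂ ∞ f := by
  intro x
  have hx := hp (f x)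
  refine (hx.localInverse_contMDiffAt.comp x hpf.contMDiffAt).congr_of_eventuallyEq ?_
  filter_upwards [hf.continuousAt.eventually hx.localInverse_eventuallyEq_left] with y hy
  exact hy.symm

theorem IsUniversalCovering.nonempty_diffeomorph [LocallyPathConnectedSpace X]
    [LocallyPathConnectedSpace Y] {p : X → Z} {q : Y → Z} (hp : IsUniversalCovering I₁ I₃ p)
    (hq : IsUniversalCovering I₂ I₃ q) : Nonempty (X ≃ₘ^∞⟮I₁, I₂⟯ Y) := by
  obtain ⟨_, hp_cov, -, hp_diffeo⟩ := hp
  obtain ⟨_, hq_cov, hq_surj, hq_diffeo⟩ := hq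
  obtain ⟨x₀⟩ : Nonempty X := inferInstance
  obtain ⟨y₀, hy₀⟩ := hq_surj (p x₀)
  obtain ⟨f, ⟨hf₀, hf : q ∘ f = p⟩, -⟩ :=
    hq_cov.existsUnique_continuousMap_lifts ⟨p, hp_cov.continuous⟩ x₀ y₀ hy₀
  obtain ⟨h, ⟨hh₀, hh : p ∘ h = q⟩, -⟩ :=
    hp_cov.existsUnique_continuousMap_lifts ⟨q, hq_cov.continuous⟩ y₀ x₀ hy₀.symm
  have hleft : ⇑h ∘ ⇑f = id := hp_cov.eq_of_comp_eq (h.continuous.comp f.continuous) continuous_id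
    (by rw [← Function.comp_assoc, hh, hf, Function.comp_id]) x₀ (by simp [hf₀, hh₀])
  have hright : ⇑f ∘ ⇑h = id := hq_cov.eq_of_comp_eq (f.continuous.comp h.continuous) continuous_id
    (by rw [← Function.comp_assoc, hf, hh, Function.comp_id]) y₀ (by simp [hf₀, hh₀])
  exact ⟨⟨⟨f, h, congrFun hleft, congrFun hright⟩,
    contMDiff_of_comp_isLocalDiffeomorph hq_diffeo f.continuous (hf.symm ▸ hp_diffeo.contMDiff),
    contMDiff_of_comp_isLocalDiffeomorph hp_diffeo h.continuous (hh.symm ▸ hq_diffeo.contMDiff)⟩⟩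

end Coverings

/-! ### The universal covering -/

section UniversalCovering

instance contractibleSpace_upperHalfSpace (k : ℕ) : ContractibleSpace (upperHalfSpace k) := by
  have hconvex : Convex ℝ {y : EuclideanSpace ℝ (Fin (k + 1)) | 0 < y 0} :=
    (convex_Ioi (0 : ℝ)).linear_preimage
      (EuclideanSpace.proj (𝕜 := ℝ) (0 : Fin (k + 1))).toLinearMap
  exact hconvex.contractibleSpace ⟨EuclideanSpace.single 0 1, by simp⟩

/-- The coordinates `(log y₀, y₁, …, y_k)` on the half-space, identifying it with Euclidean space
as a smooth manifold. -/
def upperHalfSpaceDiffeomorph (k : ℕ) :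
    upperHalfSpace k ≃ₘ^∞⟮𝓡 (k + 1), 𝓡 (k + 1)⟯ EuclideanSpace ℝ (Fin (k + 1)) where
  toFun y := WithLp.toLp 2 (Fin.cons (Real.log (y.1 0)) fun i => y.1 i.succ)
  invFun z := ⟨WithLp.toLp 2 (Fin.cons (Real.exp (z 0)) fun i => z i.succ), Real.exp_pos _⟩
  left_inv y := Subtype.ext <| PiLp.ext <| Fin.cases (Real.exp_log y.2) fun _ => rfl
  right_inv z := PiLp.ext <| Fin.cases (Real.log_exp (z 0)) fun _ => rfl
  contMDiff_toFun := by
    intro y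
    refine contMDiffAt_subtype_iff (f := fun y : EuclideanSpace ℝ (Fin (k + 1)) =>
      (WithLp.toLp 2 (Fin.cons (Real.log (y 0)) fun i => y i.succ) :
        EuclideanSpace ℝ (Fin (k + 1)))) |>.2 ?_
    rw [contMDiffAt_iff_contDiffAt, contDiffAt_euclidean]
    refine Fin.cases ?_ fun j => ?_
    · exact ContDiffAt.log (by fun_prop) (ne_of_gt y.2)
    · simp only [Fin.cons_succ]
      fun_prop
  contMDiff_invFun := by
    refine (ContMDiff.subtypeVal_comp_iff _ _).1 (ContDiff.contMDiff ?_)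
    refine contDiff_euclidean.2 (Fin.cases ?_ fun j => ?_)
    · exact Real.contDiff_exp.comp (by fun_prop)
    · change ContDiff ℝ ∞ fun z : EuclideanSpace ℝ (Fin (k + 1)) => z j.succ
      fun_prop

theorem isUniversalCovering_prodMap_id {X : Type*} [TopologicalSpace X] [SimplyConnectedSpace X]
    {E : Type*} [NormedAddCommGroup E] [NormedSpace ℝ E] {H : Type*} [TopologicalSpace H]
    {I : ModelWithCorners ℝ E H} [ChartedSpace H X] {k : ℕ} {S : Type*} [TopologicalSpace S]
    [ChartedSpace (EuclideanSpace ℝ (Fin (k + 1))) S] {p : upperHalfSpace k → S}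
    (hp : IsSmoothCovering (𝓡 (k + 1)) (𝓡 (k + 1)) p) :
    IsUniversalCovering (I.prod (𝓡 (k + 1))) (I.prod (𝓡 (k + 1)))
      (Prod.map (id : X → X) p) :=
  ⟨simplyConnectedSpace_prod, hp.prodMap_id⟩

theorem simplyConnectedSpace_unitSphere {m : ℕ} (hm : 2 ≤ m) :
    SimplyConnectedSpace (UnitSphere m) :=
  simplyConnectedSpace_sphere (by rw [finrank_euclideanSpace_fin]; omega)

theorem nonempty_diffeomorph_unitSphere_prod_of_isUniversalCovering {m k : ℕ} (hm : 2 ≤ m)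
    {S : Type*} [TopologicalSpace S] [ChartedSpace (EuclideanSpace ℝ (Fin (k + 1))) S]
    {p : upperHalfSpace k → S} (hp : IsSmoothCovering (𝓡 (k + 1)) (𝓡 (k + 1)) p)
    {M : Type*} [TopologicalSpace M]
    [ChartedSpace (ModelProd (EuclideanSpace ℝ (Fin m)) (EuclideanSpace ℝ (Fin (k + 1)))) M]
    {π : M → UnitSphere m × S}
    (hπ : IsUniversalCovering ((𝓡 m).prod (𝓡 (k + 1))) ((𝓡 m).prod (𝓡 (k + 1))) π) :
    Nonempty (M ≃ₘ^∞⟮(𝓡 m).prod (𝓡 (k + 1)), (𝓡 m).prod (𝓡 (k + 1))⟯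
      (UnitSphere m × EuclideanSpace ℝ (Fin (k + 1)))) := by
  have := simplyConnectedSpace_unitSphere hm
  have : LocallyPathConnectedSpace
      (ModelProd (EuclideanSpace ℝ (Fin m)) (EuclideanSpace ℝ (Fin (k + 1)))) :=
    inferInstanceAs (LocallyPathConnectedSpace (_ × _))
  have : LocallyPathConnectedSpace M := ChartedSpace.locallyPathConnectedSpace
    (ModelProd (EuclideanSpace ℝ (Fin m)) (EuclideanSpace ℝ (Fin (k + 1)))) M
  have : LocallyPathConnectedSpace (UnitSphere m × upperHalfSpace k) :=
    ChartedSpace.locallyPathConnectedSpace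
      (ModelProd (EuclideanSpace ℝ (Fin m)) (EuclideanSpace ℝ (Fin (k + 1)))) _
  obtain ⟨Φ⟩ := hπ.nonempty_diffeomorph (isUniversalCovering_prodMap_id hp)
  exact ⟨Φ.trans ((Diffeomorph.refl (𝓡 m) (UnitSphere m) ∞).prodCongr
    (upperHalfSpaceDiffeomorph k))⟩

theorem not_contractibleSpace_unitSphere_prod {m : ℕ} {Y : Type*} [TopologicalSpace Y]
    [ContractibleSpace Y] : ¬ ContractibleSpace (UnitSphere m × Y) := fun _ =>
  not_contractibleSpace_sphere (contractibleSpace_of_prod_left (X := UnitSphere m) (Y := Y))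

end UniversalCovering

section Product

variable {m k : ℕ} {S : Type*} [TopologicalSpace S]
  [ChartedSpace (EuclideanSpace ℝ (Fin (k + 1))) S] [IsManifold (𝓡 (k + 1)) ∞ S]

theorem isInnerProduct_riemannianTensor
    (g : Bundle.ContMDiffRiemannianMetric (𝓡 (k + 1)) ∞ (EuclideanSpace ℝ (Fin (k + 1)))
      (TangentSpace (𝓡 (k + 1)) : S → Type _)) (s : S) :
    IsInnerProduct (riemannianTensor g s) :=
  ⟨g.symm s, g.pos s⟩

theorem isContinuousMetric_roundMetric_prod {g : TwoTensor (𝓡 (k + 1)) S}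
    {p : upperHalfSpace k → S} (hp : IsRiemannianCovering (hyperbolicMetric k) g p)
    (hg : ∀ s, IsInnerProduct (g s)) : IsContinuousMetric ((roundMetric m).prod g) :=
  ⟨TwoTensor.isInnerProduct_prod (isInnerProduct_roundMetric m) hg,
    continuousOn_chartCoefficients_roundMetric_prod hp hg⟩

end Product

end

theorem mainTheorem5 (k n : ℕ) (hn : 2 * k + 3 ≤ n)
    (S : Type*) [TopologicalSpace S] [T2Space S] [SecondCountableTopology S]
    [ChartedSpace (EuclideanSpace ℝ (Fin (k + 1))) S] [IsManifold (𝓡 (k + 1)) ∞ S]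
    [MeasurableSpace S] [BorelSpace S]
    (gS : Bundle.ContMDiffRiemannianMetric (𝓡 (k + 1)) ∞ (EuclideanSpace ℝ (Fin (k + 1)))
      (TangentSpace (𝓡 (k + 1)) : S → Type _))
    (hS : IsCompactHyperbolic (riemannianTensor gS)) :
    -- the product metric has constant positive scalar curvature
    (∀ x : UnitSphere (n - k - 1) × S,
      scalarCurvature ((roundMetric (n - k - 1)).prod (riemannianTensor gS)) x
        = ((n : ℝ) - 2 * k - 2) * ((n : ℝ) - 1)) ∧
    0 < ((n : ℝ) - 2 * k - 2) * ((n : ℝ) - 1) ∧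
    -- its conformal class has positive Yamabe constant
    0 < yamabeConstant ((roundMetric (n - k - 1)).prod (riemannianTensor gS)) ∧
    -- the product of the sphere with the hyperbolic covering is a universal Riemannian covering
    (∀ p : upperHalfSpace k → S,
      IsRiemannianCovering (hyperbolicMetric k) (riemannianTensor gS) p →
        IsUniversalCovering ((𝓡 (n - k - 1)).prod (𝓡 (k + 1))) ((𝓡 (n - k - 1)).prod (𝓡 (k + 1)))
          (Prod.map id p : UnitSphere (n - k - 1) × upperHalfSpace k →
            UnitSphere (n - k - 1) × S) ∧
        IsRiemannianCovering ((roundMetric (n - k - 1)).prod (hyperbolicMetric k))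
          ((roundMetric (n - k - 1)).prod (riemannianTensor gS)) (Prod.map id p)) ∧
    -- every universal covering is diffeomorphic to `S^{n-k-1} × ℝ^{k+1}`, is not contractible, and
    -- with the pulled back metric is not conformally equivalent to Euclidean space
    (∀ (M : Type*) [TopologicalSpace M]
      [ChartedSpace (ModelProd (EuclideanSpace ℝ (Fin (n - k - 1)))
        (EuclideanSpace ℝ (Fin (k + 1)))) M]
      [IsManifold ((𝓡 (n - k - 1)).prod (𝓡 (k + 1))) ∞ M]
      (π : M → UnitSphere (n - k - 1) × S),
      IsUniversalCovering ((𝓡 (n - k - 1)).prod (𝓡 (k + 1)))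
          ((𝓡 (n - k - 1)).prod (𝓡 (k + 1))) π →
        Nonempty (M ≃ₘ^∞⟮(𝓡 (n - k - 1)).prod (𝓡 (k + 1)),
          (𝓡 (n - k - 1)).prod (𝓡 (k + 1))⟯
            (UnitSphere (n - k - 1) × EuclideanSpace ℝ (Fin (k + 1)))) ∧
        ¬ ContractibleSpace M ∧
        ¬ ConformallyEquivalent
          (TwoTensor.pullback ((𝓡 (n - k - 1)).prod (𝓡 (k + 1)))
            ((roundMetric (n - k - 1)).prod (riemannianTensor gS)) π)
          (flatMetric n)) := by
  obtain ⟨hcompact, p₀, hp₀⟩ := hS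
  obtain ⟨m, rfl⟩ : ∃ m, n = m + k + 1 := ⟨n - k - 1, by omega⟩
  rw [show m + k + 1 - k - 1 = m by omega]
  have hg := isInnerProduct_riemannianTensor gS
  have hscal (x : UnitSphere m × S) :
      scalarCurvature ((roundMetric m).prod (riemannianTensor gS)) x =
        (((m + k + 1 : ℕ) : ℝ) - 2 * k - 2) * (((m + k + 1 : ℕ) : ℝ) - 1) := by
    rw [scalarCurvature_roundMetric_prod hp₀ hg x]
    push_cast
    ring
  have hpos : 0 < (((m + k + 1 : ℕ) : ℝ) - 2 * k - 2) * (((m + k + 1 : ℕ) : ℝ) - 1) := by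
    have hkm : ((2 * k + 3 : ℕ) : ℝ) ≤ ((m + k + 1 : ℕ) : ℝ) := Nat.cast_le.2 hn
    push_cast at hkm ⊢
    exact mul_pos (by linarith) (by linarith)
  have := simplyConnectedSpace_unitSphere (m := m) (by omega)
  have : Nonempty S := ⟨p₀ (Classical.arbitrary _)⟩
  refine ⟨hscal, hpos, (isContinuousMetric_roundMetric_prod hp₀ hg).yamabeConstant_pos
    (by simp; omega) hpos hscal, fun p hp => ⟨isUniversalCovering_prodMap_id hp.1,
      hp.prodMap_id _⟩, fun M _ _ _ π hπ => ?_⟩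
  obtain ⟨Φ⟩ := nonempty_diffeomorph_unitSphere_prod_of_isUniversalCovering (by omega) hp₀.1 hπ
  have hnot : ¬ ContractibleSpace M := fun _ =>
    not_contractibleSpace_unitSphere_prod Φ.toHomeomorph.symm.contractibleSpace
  exact ⟨⟨Φ⟩, hnot, fun ⟨F, _⟩ => hnot F.toHomeomorph.contractibleSpace⟩
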